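/- Represented spaces, realizers and computable partial functions on $\mathbb{N}^\mathbb{N}$ are those of computable analysis. For partial multivalued functions $f,g$ between represented spaces, $f\leq_{\mathrm W} g$ means that there are computable $K,H:\subseteq\mathbb{N}^\mathbb{N}\to\mathbb{N}^\mathbb{N}$ such that $p\mapsto K\langle p,G(H(p))\rangle$ realizes $f$ whenever $G$ realizes $g$; and $f\equiv_{\mathrm W} g$ means $f\leq_{\mathrm W} g$ and $g\leq_{\mathrm W} f$. Consider infinite sequential games with two players $a,b$, a finite set $O$ of outcomes, a map $d:\{0,1\}^*\to\{a,b\}$ saying who moves after each history, an outcome function $v:\{0,1\}^\mathbb{N}\to O$, and strict linear preferences $\prec_a,\prec_b$ on $O$ that are antagonistic, i.e. $\prec_a=\prec_b^{-1}$, such that for either player and every upper set $S\subseteq O$ of that player's preference the set of plays $v^{-1}(S)$ is open or closed in $\{0,1\}^\mathbb{N}$. Such a game is represented by the number of its outcomes, look-up tables for $d$, $\prec_a$ and $\prec_b$, and, for either player and each (non-empty) upper set $S$, a name of $v^{-1}(S)$, namely one bit telling whether it is presented as an open or as a closed set together with an enumeration of cylinders $w\{0,1\}^\mathbb{N}$ exhausting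 $v^{-1}(S)$ or its complement, respectively. A strategy profile is a function $\sigma:\{0,1\}^*\to\{0,1\}$, represented as a point of Cantor space via a standard coding of words by numbers; it is a Nash equilibrium if no player can change $\sigma$ at the histories where he moves so that the outcome of the induced play becomes one he prefers. Let $\mathrm{NE}^{ap}_{\mathcal{O}\cup\mathcal{A}}$ be the multivalued function mapping such a game to any of its Nash equilibria. Let $\mathrm{C}_{\{0,1\}^\mathbb{N}}$ map a non-empty closed subset of $\{0,1\}^\mathbb{N}$, given by an enumeration of cylinders exhausting its complement, to any of its points. Let $\mathrm{LPO}:\mathbb{N}^\mathbb{N}\to\{0,1\}$ be the characteristic function of $\{0^\mathbb{N}\}$, and let $\mathrm{LPO}^*$ map a number $n$ together with $p_1,\dots,p_n\in\mathbb{N}^\mathbb{N}$ to $(\mathrm{LPO}(p_1),\dots,\mathrm{LPO}(p_n))$. Then $$\mathrm{NE}^{ap}_{\mathcal{O}\cup\mathcal{A}}\equiv_{\mathrm W}\mathrm{C}_{\{0,1\}^\mathbb{N}}\times\mathrm{LPO}^*.$$ -/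

import Mathlib

namespace Weihrauch

universe u v w z

/-! ## Computability on Baire space -/

/-- The finite word `p 0, …, p (n - 1)` of an infinite sequence. -/
def initSeg {α : Type*} (p : ℕ → α) (n : ℕ) : List α :=
  (List.range n).map p

/-- A partial function on Baire space is computable (type-two computability) if some computable
word function that is monotone with respect to the initial segment order produces,
on the initial segments of any `p` in the domain, arbitrarily long initial segments of `F p`. -/
def ComputableOnBaire (F : (ℕ → ℕ) →. (ℕ → ℕ)) : Prop :=
  ∃ h : List ℕ → List ℕ, Computable h ∧ (∀ u v, u <+: v → h u <+: h v) ∧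
    ∀ p q, q ∈ F p → ∀ m, ∃ n, initSeg q m <+: h (initSeg p n)

/-- The pairing of two points of Baire space, `⟨p, q⟩ (2 n) = p n` and `⟨p, q⟩ (2 n + 1) = q n`. -/
def pairSeq (p q : ℕ → ℕ) : ℕ → ℕ :=
  fun n => if n % 2 = 0 then p (n / 2) else q (n / 2)

/-- The `i`-th column of a point of Baire space. -/
def col (p : ℕ → ℕ) (i : ℕ) : ℕ → ℕ :=
  fun k => p (Nat.pair i k)

/-! ## Represented spaces and Weihrauch reducibility -/

/-- A represented space: a partial surjection from Baire space onto `X`, given by its graph;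
`Names p x` says that `p` is a name of `x`. -/
class Represented (X : Type u) where
  Names : (ℕ → ℕ) → X → Prop
  unique : ∀ p x y, Names p x → Names p y → x = y
  surj : ∀ x, ∃ p, Names p x

open Represented

/-- `F` realizes the partial multivalued function `f`; the domain of `f` consists of the points
with a non-empty set of values. -/
def Realizes {X : Type u} {Y : Type v} [Represented X] [Represented Y]
    (F : (ℕ → ℕ) →. (ℕ → ℕ)) (f : X → Set Y) : Prop :=
  ∀ p x, Names p x → (f x).Nonempty → ∃ q ∈ F p, ∃ y ∈ f x, Names q y

/-- Weihrauch reducibility: there are computable `K`, `H` such that `p ↦ K ⟨p, G (H p)⟩`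
realizes `f` whenever `G` realizes `g`. -/
def Reducible {X : Type u} {Y : Type v} {Z : Type w} {W : Type z}
    [Represented X] [Represented Y] [Represented Z] [Represented W]
    (f : X → Set Y) (g : Z → Set W) : Prop :=
  ∃ K H : (ℕ → ℕ) →. (ℕ → ℕ), ComputableOnBaire K ∧ ComputableOnBaire H ∧
    ∀ G : (ℕ → ℕ) →. (ℕ → ℕ), Realizes G g →
      Realizes (fun p => (H p).bind fun q => (G q).bind fun r => K (pairSeq p r)) f

/-- Weihrauch equivalence. -/
def Equivalent {X : Type u} {Y : Type v} {Z : Type w} {W : Type z}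
    [Represented X] [Represented Y] [Represented Z] [Represented W]
    (f : X → Set Y) (g : Z → Set W) : Prop :=
  Reducible f g ∧ Reducible g f

/-! ## Basic represented spaces -/

theorem toNat_inj {a b : Bool} (h : a.toNat = b.toNat) : a = b := by
  cases a <;> cases b <;> simp_all

instance : Represented (ℕ → ℕ) where
  Names p x := p = x
  unique := by rintro p x y rfl rfl; rfl
  surj x := ⟨x, rfl⟩

instance : Represented Bool where
  Names p b := p 0 = b.toNat
  unique := by
    intro p x y hx hy
    exact toNat_inj (hx.symm.trans hy)
  surj b := ⟨fun _ => b.toNat, rfl⟩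

/-- Cantor space. -/
instance : Represented (ℕ → Bool) where
  Names p x := ∀ n, p n = (x n).toNat
  unique := by
    intro p x y hx hy
    funext n
    exact toNat_inj ((hx n).symm.trans (hy n))
  surj x := ⟨fun n => (x n).toNat, fun _ => rfl⟩

/-- Functions on binary words, named through the standard coding of words by numbers. -/
instance : Represented (List Bool → Bool) where
  Names p s := ∀ u : List Bool, p (Encodable.encode u) = (s u).toNat
  unique := by
    intro p x y hx hy
    funext u
    exact toNat_inj ((hx u).symm.trans (hy u))
  surj s := by
    refine ⟨fun n => ((Encodable.decode n).elim false s).toNat, fun u => ?_⟩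
    simp

instance {X : Type u} {Y : Type v} [Represented X] [Represented Y] : Represented (X × Y) where
  Names p a := Names (fun n => p (2 * n)) a.1 ∧ Names (fun n => p (2 * n + 1)) a.2
  unique := by
    intro p a b ha hb
    exact Prod.ext (unique _ _ _ ha.1 hb.1) (unique _ _ _ ha.2 hb.2)
  surj a := by
    obtain ⟨p, hp⟩ := surj a.1
    obtain ⟨q, hq⟩ := surj a.2
    refine ⟨pairSeq p q, ?_, ?_⟩
    · have : (fun n => pairSeq p q (2 * n)) = p := by
        funext n; simp [pairSeq]
      rw [this]; exact hp
    · have : (fun n => pairSeq p q (2 * n + 1)) = q := by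
        funext n
        have h1 : (2 * n + 1) % 2 = 1 := by omega
        have h2 : (2 * n + 1) / 2 = n := by omega
        simp [pairSeq, h1, h2]
      rw [this]; exact hq

/-- Finite tuples of arbitrary length; a name starts with the length. -/
instance {X : Type u} [Represented X] : Represented (Σ n : ℕ, Fin n → X) where
  Names p a := p 0 = a.1 ∧ ∀ i : Fin a.1, Names (col (fun n => p (n + 1)) i) (a.2 i)
  unique := by
    rintro p ⟨n, x⟩ ⟨m, y⟩ ⟨hn, hx⟩ ⟨hm, hy⟩
    obtain rfl : n = m := hn.symm.trans hm
    have : x = y := by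
      funext i
      exact unique _ _ _ (hx i) (hy i)
    rw [this]
  surj := by
    rintro ⟨n, x⟩
    choose q hq using fun i => surj (x i)
    refine ⟨fun k => Nat.casesOn k n fun m =>
      if h : (Nat.unpair m).1 < n then q ⟨_, h⟩ (Nat.unpair m).2 else 0, rfl, fun i => ?_⟩
    have : col (fun m => if h : (Nat.unpair m).1 < n then q ⟨_, h⟩ (Nat.unpair m).2 else 0) i
        = q i := by
      funext k
      simp [col]
    change Names (col (fun m =>
      if h : (Nat.unpair m).1 < n then q ⟨_, h⟩ (Nat.unpair m).2 else 0) i) (x i)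
    rw [this]
    exact hq i

/-! ## Operations on multivalued functions -/

/-- The product `f × g`. -/
def prod {X : Type u} {Y : Type v} {Z : Type w} {W : Type z}
    (f : X → Set Y) (g : Z → Set W) : X × Z → Set (Y × W) :=
  fun a => f a.1 ×ˢ g a.2

/-- The operation `f ↦ f^*`, any finite number of parallel uses of `f`: an instance is a tuple
`x₁, …, xₙ` together with its length, and a solution is a tuple of solutions. -/
def star {X : Type u} {Y : Type v} (f : X → Set Y) :
    (Σ n : ℕ, Fin n → X) → Set (Σ n : ℕ, Fin n → Y) :=
  fun a => {b | ∃ y : Fin a.1 → Y, (∀ i, y i ∈ f (a.2 i)) ∧ b = ⟨a.1, y⟩}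

/-- `LPO`, the characteristic function of the zero sequence. -/
def LPO : (ℕ → ℕ) → Set Bool :=
  fun p => {b | b = true ↔ ∀ n, p n = 0}

/-! ## Open and closed subsets of Cantor space -/

/-- The set of all infinite binary sequences that start with the word `u`. -/
def cylinder (u : List Bool) : Set (ℕ → Bool) :=
  {x | initSeg x u.length = u}

/-- The union of the cylinders enumerated by `p`; the value `0` stands for `no information`. -/
def enumeratedOpen (p : ℕ → ℕ) : Set (ℕ → Bool) :=
  {x | ∃ n, ∃ u : List Bool, p n = Encodable.encode u + 1 ∧ x ∈ cylinder u}

theorem exists_enumeratedOpen {U : Set (ℕ → Bool)} (hU : IsOpen U) :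
    ∃ p, enumeratedOpen p = U := by
  classical
  refine ⟨fun n => if ∃ u : List Bool, n = Encodable.encode u + 1 ∧ cylinder u ⊆ U then n else 0,
    ?_⟩
  ext x
  constructor
  · rintro ⟨n, u, hn, hx⟩
    dsimp only at hn
    split_ifs at hn with h
    obtain ⟨u', hu', hs⟩ := h
    obtain rfl : u' = u := Encodable.encode_injective (by omega)
    exact hs hx
  · intro hx
    obtain ⟨V, ⟨y, n, rfl⟩, hxV, hVU⟩ :=
      (PiNat.isTopologicalBasis_cylinders (fun _ : ℕ => Bool)).exists_subset_of_mem_open hx hU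
    have hxy : ∀ i < n, x i = y i := hxV
    refine ⟨Encodable.encode (initSeg x n) + 1, initSeg x n, ?_, ?_⟩
    · refine if_pos ⟨_, rfl, fun a ha => hVU ?_⟩
      intro i hi
      have ha' : initSeg a n = initSeg x n := by simpa [cylinder, initSeg] using ha
      have : a i = x i := by
        have := List.map_inj_left.1 ha' i (List.mem_range.2 hi)
        exact this
      rw [this, hxy i hi]
    · simp [cylinder, initSeg]

/-- The space of closed subsets of Cantor space, represented by enumerations of the
complement. -/
instance : Represented (TopologicalSpace.Closeds (ℕ → Bool)) where
  Names p A := (A : Set (ℕ → Bool)) = (enumeratedOpen p)ᶜ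
  unique := by
    intro p A B hA hB
    exact SetLike.coe_injective (hA.trans hB.symm)
  surj A := by
    obtain ⟨p, hp⟩ := exists_enumeratedOpen A.isClosed.isOpen_compl
    exact ⟨p, by rw [hp, compl_compl]⟩

/-- Closed choice on Cantor space: given a non-empty closed set, find a point in it. -/
def closedChoiceCantor : TopologicalSpace.Closeds (ℕ → Bool) → Set (ℕ → Bool) :=
  fun A => A

/-- The pointclass of all sets that are open or closed. -/
def OpenOrClosed : Type :=
  {A : Set (ℕ → Bool) // IsOpen A ∨ IsClosed A}

/-- A name of an open or closed set starts with a tag, `0` for open and `1` for closed,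
followed by an enumeration of the set or of its complement, respectively. -/
instance : Represented OpenOrClosed where
  Names p A :=
    (p 0 = 0 ∧ A.1 = enumeratedOpen fun n => p (n + 1)) ∨
    (p 0 = 1 ∧ A.1 = (enumeratedOpen fun n => p (n + 1))ᶜ)
  unique := by
    rintro p A B (⟨h, hA⟩ | ⟨h, hA⟩) (⟨h', hB⟩ | ⟨h', hB⟩)
    · exact Subtype.ext (hA.trans hB.symm)
    · omega
    · omega
    · exact Subtype.ext (hA.trans hB.symm)
  surj := by
    rintro ⟨A, hA | hA⟩
    · obtain ⟨p, hp⟩ := exists_enumeratedOpen hA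
      exact ⟨fun n => Nat.casesOn n 0 p, Or.inl ⟨rfl, hp.symm⟩⟩
    · obtain ⟨p, hp⟩ := exists_enumeratedOpen hA.isOpen_compl
      refine ⟨fun n => Nat.casesOn n 1 p, Or.inr ⟨rfl, ?_⟩⟩
      change A = (enumeratedOpen p)ᶜ
      rw [hp, compl_compl]

/-! ## Infinite sequential games -/

/-- An infinite sequential game with agents `A`, choices `C` and outcomes `O`;
`pref a x y` says that agent `a` prefers `y` to `x`. -/
structure SequentialGame (A C O : Type) where
  mover : List C → A
  value : (ℕ → C) → O
  pref : A → O → O → Prop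

/-- The history of length `n` that is induced by a strategy profile. -/
def inducedHistory {C : Type} (s : List C → C) : ℕ → List C
  | 0 => []
  | n + 1 => inducedHistory s n ++ [s (inducedHistory s n)]

/-- The play that is induced by a strategy profile. -/
def inducedPlay {C : Type} (s : List C → C) : ℕ → C :=
  fun n => s (inducedHistory s n)

open Classical in
/-- The profile `s` with the strategy of agent `a` replaced by `t`. -/
noncomputable def deviate {A C O : Type} (G : SequentialGame A C O) (s : List C → C) (a : A)
    (t : {u : List C // G.mover u = a} → C) : List C → C :=
  fun u => if h : G.mover u = a then t ⟨u, h⟩ else s u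

/-- Nash equilibria: no agent prefers the outcome of a unilateral deviation. -/
def IsNash {A C O : Type} (G : SequentialGame A C O) (s : List C → C) : Prop :=
  ∀ (a : A) (t : {u : List C // G.mover u = a} → C),
    ¬ G.pref a (G.value (inducedPlay s)) (G.value (inducedPlay (deviate G s a t)))

/-- Two-player games on binary words with finitely many outcomes and antagonistic (strict) linear
preferences, where the set of plays with outcome in any upper set of outcomes, with respect to the
preference of either player, is open or closed. -/
structure AntagonisticGame where
  numOutcomes : ℕ
  game : SequentialGame (Fin 2) Bool (Fin numOutcomes)
  pref_irrefl : ∀ i x, ¬ game.pref i x x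
  pref_trans : ∀ i x y z, game.pref i x y → game.pref i y z → game.pref i x z
  pref_total : ∀ i x y, game.pref i x y ∨ x = y ∨ game.pref i y x
  antagonistic : ∀ x y, game.pref 0 x y ↔ game.pref 1 y x
  upper_openOrClosed : ∀ (i : Fin 2) (S : Set (Fin numOutcomes)),
    (∀ x y, x ∈ S → game.pref i x y → y ∈ S) →
      IsOpen (game.value ⁻¹' S) ∨ IsClosed (game.value ⁻¹' S)

/-- The set of plays whose outcome is, for player `i`, the outcome `x` or better. In a finite linear
order these `{y | x ≤ y}` are all the non-empty upper sets. -/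
def AntagonisticGame.upperPlays (G : AntagonisticGame) (i : Fin 2) (x : Fin G.numOutcomes) :
    OpenOrClosed :=
  ⟨G.game.value ⁻¹' {y | x = y ∨ G.game.pref i x y}, G.upper_openOrClosed i _ (by
    rintro y y' (rfl | h) hy
    · exact Or.inr hy
    · exact Or.inr (G.pref_trans i _ _ _ h hy))⟩

/-- A name of a game consists of the number of outcomes, look-up tables for the mover and for
the preferences, and for either player and each non-empty upper set of outcomes a name of
the open or closed set of plays that lead into it. -/
def AntagonisticGame.IsName (p : ℕ → ℕ) (G : AntagonisticGame) : Prop :=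
  col p 0 0 = G.numOutcomes ∧
  (∀ u : List Bool, col p 1 (Encodable.encode u) = G.game.mover u) ∧
  (∀ (i : Fin 2) (x y : Fin G.numOutcomes),
    (G.game.pref i x y ∧ col p 2 (Nat.pair i (Nat.pair x y)) = 1) ∨
    (¬ G.game.pref i x y ∧ col p 2 (Nat.pair i (Nat.pair x y)) = 0)) ∧
  ∀ (i : Fin 2) (x : Fin G.numOutcomes), Names (col p (Nat.pair i x + 3)) (G.upperPlays i x)

theorem AntagonisticGame.isName_unique (p : ℕ → ℕ) (G G' : AntagonisticGame)
    (h : G.IsName p) (h' : G'.IsName p) : G = G' := by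
  obtain ⟨n, ⟨d, v, r⟩, hi, ht, hl, ha, ho⟩ := G
  obtain ⟨n', ⟨d', v', r'⟩, hi', ht', hl', ha', ho'⟩ := G'
  obtain ⟨h1, h2, h3, h4⟩ := h
  obtain ⟨h1', h2', h3', h4'⟩ := h'
  obtain rfl : n = n' := h1.symm.trans h1'
  obtain rfl : d = d' := by
    funext u
    exact Fin.ext ((h2 u).symm.trans (h2' u))
  obtain rfl : r = r' := by
    funext i x y
    rcases h3 i x y with ⟨a, b⟩ | ⟨a, b⟩ <;> rcases h3' i x y with ⟨a', b'⟩ | ⟨a', b'⟩ <;>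
      simp only at a b a' b'
    · exact propext ⟨fun _ => a', fun _ => a⟩
    · omega
    · omega
    · exact propext ⟨fun h => absurd h a, fun h => absurd h a'⟩
  obtain rfl : v = v' := by
    funext x
    have key : ∀ o, (o = v x ∨ r 0 o (v x)) ↔ (o = v' x ∨ r 0 o (v' x)) := fun o =>
      Set.ext_iff.1 (congrArg (fun A : OpenOrClosed => A.1) (unique _ _ _ (h4 0 o) (h4' 0 o))) x
    rcases (key (v x)).1 (Or.inl rfl) with e | e
    · exact e
    · rcases (key (v' x)).2 (Or.inl rfl) with e' | e'
      · exact e'.symm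
      · exact absurd (ht 0 _ _ _ e e') (hi 0 _)
  rfl

theorem AntagonisticGame.exists_isName (G : AntagonisticGame) : ∃ p, G.IsName p := by
  classical
  choose q hq using fun i x => surj (G.upperPlays i x)
  let c : ℕ → ℕ → ℕ := fun j k => match j with
    | 0 => G.numOutcomes
    | 1 => (Encodable.decode (α := List Bool) k).elim 0 fun u => (G.game.mover u : ℕ)
    | 2 => if ∃ (i : Fin 2) (x y : Fin G.numOutcomes),
        k = Nat.pair i (Nat.pair x y) ∧ G.game.pref i x y then 1 else 0
    | m + 3 => if h : (Nat.unpair m).1 < 2 ∧ (Nat.unpair m).2 < G.numOutcomes then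
        q ⟨_, h.1⟩ ⟨_, h.2⟩ k else 0
  have hc : ∀ j, col (fun n => c (Nat.unpair n).1 (Nat.unpair n).2) j = c j := by
    intro j; funext k; simp [col]
  refine ⟨fun n => c (Nat.unpair n).1 (Nat.unpair n).2, ?_, ?_, ?_, ?_⟩
  · rw [hc]
  · intro u; rw [hc]; simp [c]
  · intro i x y
    rw [hc]
    by_cases h : G.game.pref i x y
    · exact Or.inl ⟨h, if_pos ⟨i, x, y, rfl, h⟩⟩
    · refine Or.inr ⟨h, if_neg ?_⟩
      rintro ⟨i', x', y', e, h'⟩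
      obtain ⟨e1, e2⟩ := Nat.pair_eq_pair.1 e
      obtain ⟨e2, e3⟩ := Nat.pair_eq_pair.1 e2
      obtain rfl := Fin.ext e1
      obtain rfl := Fin.ext e2
      obtain rfl := Fin.ext e3
      exact h h'
  · intro i x
    rw [hc]
    have : c (Nat.pair i x + 3) = q i x := by
      funext k
      have h2 : (i : ℕ) < 2 := i.isLt
      simp [c, show ¬ 1 < (i : ℕ) by omega]
    rw [this]
    exact hq i x

instance : Represented AntagonisticGame where
  Names p G := G.IsName p
  unique := AntagonisticGame.isName_unique
  surj := AntagonisticGame.exists_isName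

/-- The problem of finding a Nash equilibrium of such a game. -/
def findNash : AntagonisticGame → Set (List Bool → Bool) :=
  fun G => {s | IsNash G.game s}

end Weihrauch

namespace Weihrauch

open Represented

/-! ## Computable functions from finite approximations -/

/-! Both reductions turn on the fact that an open or closed win-lose game on Cantor space is decided
by finite evidence for one of the players.

Solving `C × LPO*` with a game: let player `0` make all moves. His first `n` bits announce which of
the sequences are zero, and the rest is meant to be a point of the closed set `A`. One false
announcement or a tail outside `A` gives payoff `0`; otherwise the payoff is one more than the
number of announcements. A payoff below a given threshold is visible after finitely many steps, so
all upper sets are open or closed. An equilibrium play has maximal payoff, which forces all and only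
the true announcements and a tail in `A` (`admissible_of_claimValue_ge`); following the profile from
the root reveals this play.

Solving a game with `C × LPO*`: for every outcome `x` consider the win-lose game in which player `0`
tries to reach `x` or better. One of the players, the open player, wants to enter an enumerated open
set, and he wins from a position exactly if a finite certificate shows it. So one instance of `LPO`
per outcome decides who wins from the root. Strategies come from closed choice: the open player
should move to the successor certified first, his opponent to the one certified last. A wrong move
is detected at a finite stage, so the families of profiles without wrong moves, one profile for each
outcome, form an effectively closed set. It is non-empty since each position has an acceptable move
(`exists_not_badMove`), and each member wins for whichever player can win
(`mem_enumeratedOpen_of_certified`, `notMem_enumeratedOpen_of_not_certified`).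

Finally both players aim at their best target: player `0` at the best outcome he can guarantee,
player `1` at the outcome, best for him, whose upper set he can avoid. These strategies meet at one
value, and antagonism makes the combination an equilibrium (`AntagonisticGame.isNash_of_win`).

All searches are bounded by the length of the prefix read so far, so primitive recursive
approximations suffice for all four translations. -/

theorem initSeg_length {α : Type*} (p : ℕ → α) (n : ℕ) : (initSeg p n).length = n := by
  simp [initSeg]

theorem getElem?_initSeg {α : Type*} (p : ℕ → α) {n k : ℕ} (h : k < n) :
    (initSeg p n)[k]? = some (p k) := by
  simp [initSeg, h]

theorem getD_initSeg (p : ℕ → ℕ) {n k : ℕ} (h : k < n) : (initSeg p n).getD k 0 = p k := by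
  simp [initSeg, h]

theorem getD_initSeg_of_ne_zero (p : ℕ → ℕ) {n k : ℕ} (h : (initSeg p n).getD k 0 ≠ 0) :
    k < n ∧ (initSeg p n).getD k 0 = p k := by
  by_cases hk : k < n
  · exact ⟨hk, getD_initSeg p hk⟩
  · simp [initSeg, hk] at h

theorem take_initSeg {α : Type*} (p : ℕ → α) {n k : ℕ} (h : k ≤ n) :
    (initSeg p n).take k = initSeg p k := by
  simp [initSeg, ← List.map_take, List.take_range, h]

theorem initSeg_prefix {α : Type*} (p : ℕ → α) {n k : ℕ} (h : k ≤ n) :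
    initSeg p k <+: initSeg p n := by
  rw [← take_initSeg p h]; exact List.take_prefix _ _

theorem initSeg_succ {α : Type*} (p : ℕ → α) (n : ℕ) :
    initSeg p (n + 1) = initSeg p n ++ [p n] := by
  simp [initSeg, List.range_succ]

/-- `φ` approximates `q` from the finite words of `p`: on words of `p` the partial answers of `φ`
are correct, and every position of `q` is eventually answered. -/
def Approximates (φ : List ℕ → ℕ → Option ℕ) (p q : ℕ → ℕ) : Prop :=
  (∀ k m v, φ (initSeg p k) m = some v → v = q m) ∧
    ∀ m, ∃ N, ∀ k ≥ N, (φ (initSeg p k) m).isSome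

theorem Approximates.unique {φ : List ℕ → ℕ → Option ℕ} {p q q' : ℕ → ℕ}
    (h : Approximates φ p q) (h' : Approximates φ p q') : q = q' := by
  funext m
  obtain ⟨N, hN⟩ := h.2 m
  obtain ⟨v, hv⟩ := Option.isSome_iff_exists.1 (hN N le_rfl)
  exact (h.1 _ _ _ hv).symm.trans (h'.1 _ _ _ hv)

/-- The partial function on Baire space that is approximated by `φ`. -/
noncomputable def approxFun (φ : List ℕ → ℕ → Option ℕ) : (ℕ → ℕ) →. (ℕ → ℕ) :=
  fun p => ⟨∃ q, Approximates φ p q, fun h => h.choose⟩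

theorem mem_approxFun {φ : List ℕ → ℕ → Option ℕ} {p q : ℕ → ℕ} :
    q ∈ approxFun φ p ↔ Approximates φ p q := by
  constructor
  · rintro ⟨h, rfl⟩
    exact h.choose_spec
  · intro h
    exact ⟨⟨q, h⟩, Approximates.unique (Exists.choose_spec (⟨q, h⟩ : ∃ q, Approximates φ p q)) h⟩

/-- The answers of `φ` collected in order, reading longer and longer prefixes of `u`. -/
def collect (φ : List ℕ → ℕ → Option ℕ) (u : List ℕ) : ℕ → List ℕ
  | 0 => []
  | k + 1 => collect φ u k ++ (φ (u.take k) (collect φ u k).length).toList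

theorem collect_prefix (φ : List ℕ → ℕ → Option ℕ) (u : List ℕ) {k l : ℕ} (h : k ≤ l) :
    collect φ u k <+: collect φ u l := by
  induction l, h using Nat.le_induction with
  | base => exact List.prefix_rfl
  | succ l _ ih => exact ih.trans (List.prefix_append _ _)

theorem collect_congr (φ : List ℕ → ℕ → Option ℕ) {u v : List ℕ} (h : u <+: v) {k : ℕ}
    (hk : k ≤ u.length + 1) : collect φ u k = collect φ v k := by
  induction k with
  | zero => rfl
  | succ k ih =>
    have : v.take k = u.take k := by
      obtain ⟨t, rfl⟩ := h
      rw [List.take_append_of_le_length (by omega)]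
    rw [collect, collect, ih (by omega), this]

theorem collect_primrec {φ : List ℕ → ℕ → Option ℕ} (hφ : Primrec₂ φ) :
    Primrec₂ (collect φ) := by
  have step : Primrec₂ fun (u : List ℕ) (s : ℕ × List ℕ) =>
      s.2 ++ (φ (u.take s.1) s.2.length).toList :=
    Primrec.list_append.comp (Primrec.snd.comp Primrec.snd)
      (Primrec.optionToList.comp (hφ.comp
        (Primrec.list_take.comp (Primrec.fst.comp Primrec.snd) Primrec.fst)
        (Primrec.list_length.comp (Primrec.snd.comp Primrec.snd))))
  refine (Primrec.nat_rec (Primrec.const []) step).of_eq fun u k => ?_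
  induction k with
  | zero => rfl
  | succ k ih => simp only [collect, ← ih]

/-- Step `k` of `collect` looks only at the first `k` letters, so a longer word cannot change
earlier answers. Since every entry is answered at all late stages, the collected word never stalls
for good. -/
theorem computableOnBaire_approxFun {φ : List ℕ → ℕ → Option ℕ} (hφ : Primrec₂ φ) :
    ComputableOnBaire (approxFun φ) := by
  refine ⟨fun u => collect φ u (u.length + 1), ?_, ?_, ?_⟩
  · exact ((collect_primrec hφ).comp Primrec.id
      (Primrec.succ.comp Primrec.list_length)).to_comp
  · intro u v h
    dsimp only
    rw [collect_congr φ h le_rfl]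
    exact collect_prefix φ v (by have := h.length_le; omega)
  · intro p q hq m
    rw [mem_approxFun] at hq
    have key : ∀ n, ∀ k ≤ n + 1, collect φ (initSeg p n) k =
        initSeg q (collect φ (initSeg p n) k).length := by
      intro n k
      induction k with
      | zero => intro _; simp [collect, initSeg]
      | succ k ih =>
        intro hk
        rw [collect, take_initSeg p (by omega : k ≤ n)]
        have ih := ih (by omega)
        set l := collect φ (initSeg p n) k
        cases hv : φ (initSeg p k) l.length with
        | none => simpa using ih
        | some v =>
          have := hq.1 _ _ _ hv
          simp only [Option.toList_some, List.length_append, List.length_singleton, initSeg_succ]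
          rw [← ih, this]
    have long : ∃ n, m ≤ (collect φ (initSeg p n) (n + 1)).length := by
      induction m with
      | zero => exact ⟨0, Nat.zero_le _⟩
      | succ m ih =>
        obtain ⟨n, hn⟩ := ih
        obtain ⟨N, hN⟩ := hq.2 m
        -- At this stage `m` answers are already present and `φ` answers at `m`, so a list of length
        -- exactly `m` grows.
        set k := max (n + 1) N
        have h1 : m ≤ (collect φ (initSeg p k) k).length := by
          refine hn.trans ?_
          rw [collect_congr φ (initSeg_prefix p (by omega : n ≤ k)) (by simp [initSeg_length])]
          exact (collect_prefix φ _ (by omega)).length_le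
        refine ⟨k, ?_⟩
        rw [collect, take_initSeg p le_rfl]
        rcases h1.lt_or_eq with h | h
        · rw [List.length_append]; omega
        · obtain ⟨v, hv⟩ := Option.isSome_iff_exists.1 (hN k (le_max_right _ _))
          rw [← h, hv]
          simp [← h]
    obtain ⟨n, hn⟩ := long
    refine ⟨n, ?_⟩
    dsimp only
    rw [initSeg_length, key n _ le_rfl]
    exact initSeg_prefix q hn

/-- The function on Baire space whose value at position `m` is computed by `g` from the first
`m + 2` values of the argument. -/
def prefixFun (g : List ℕ → ℕ) (p : ℕ → ℕ) : ℕ → ℕ :=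
  fun m => g (initSeg p (m + 2))

/-- The length of the prefix also tells `g` the position; the offset `2` makes entries `0` and `1`
of a name visible at every position. -/
theorem computableOnBaire_prefixFun {g : List ℕ → ℕ} (hg : Primrec g) :
    ComputableOnBaire fun p => Part.some (prefixFun g p) := by
  let φ : List ℕ → ℕ → Option ℕ := fun u m =>
    if m + 2 ≤ u.length then some (g (u.take (m + 2))) else none
  have hφ : Primrec₂ φ := by
    have h2 : Primrec fun a : List ℕ × ℕ => a.2 + 2 :=
      Primrec.nat_add.comp Primrec.snd (Primrec.const 2)
    exact Primrec.ite (Primrec.nat_le.comp h2 (Primrec.list_length.comp Primrec.fst))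
      (Primrec.option_some.comp (hg.comp (Primrec.list_take.comp h2 Primrec.fst)))
      (Primrec.const none)
  obtain ⟨h, h1, h2, h3⟩ := computableOnBaire_approxFun hφ
  refine ⟨h, h1, h2, fun p q hq => h3 p q ?_⟩
  obtain rfl := Part.mem_some_iff.1 hq
  rw [mem_approxFun]
  refine ⟨fun k m v hv => ?_, fun m => ⟨m + 2, fun k hk => ?_⟩⟩
  · simp only [φ] at hv
    split_ifs at hv with hk
    rw [initSeg_length] at hk
    rw [take_initSeg p hk] at hv
    simpa [prefixFun] using hv.symm
  · have hk : m + 2 ≤ k := hk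
    simp [φ, initSeg_length, hk]

/-! ## Bounded quantifiers -/

theorem primrecPred_exists_lt {α : Type*} [Primcodable α] {f : α → ℕ} {R : α → ℕ → Prop}
    (hf : Primrec f) (hR : PrimrecRel R) : PrimrecPred fun a => ∃ x < f a, R a x :=
  ((PrimrecRel.exists_mem_list hR.swap).comp (Primrec.list_range.comp hf) Primrec.id).of_eq
    fun a => by simp

theorem primrecPred_forall_lt {α : Type*} [Primcodable α] {f : α → ℕ} {R : α → ℕ → Prop}
    (hf : Primrec f) (hR : PrimrecRel R) : PrimrecPred fun a => ∀ x < f a, R a x :=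
  ((PrimrecRel.forall_mem_list hR.swap).comp (Primrec.list_range.comp hf) Primrec.id).of_eq
    fun a => by simp

theorem primrecPred_forall_mem {α β : Type*} [Primcodable α] [Primcodable β] {f : α → List β}
    {R : α → β → Prop} (hf : Primrec f) (hR : PrimrecRel R) :
    PrimrecPred fun a => ∀ x ∈ f a, R a x :=
  (PrimrecRel.forall_mem_list hR.swap).comp hf Primrec.id

theorem primrecPred_mem {α β : Type*} [Primcodable α] [Primcodable β] {f : α → List β}
    {g : α → β} (hf : Primrec f) (hg : Primrec g) : PrimrecPred fun a => g a ∈ f a :=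
  ((PrimrecRel.exists_mem_list (R := fun x y : β => x = y) Primrec.eq).comp hf hg).of_eq
    fun a => by simp

theorem primrec_getD {α : Type*} [Primcodable α] {f : α → List ℕ} {g : α → ℕ}
    (hf : Primrec f) (hg : Primrec g) : Primrec fun a => (f a).getD (g a) 0 :=
  (Primrec.list_getD 0).comp hf hg

theorem primrec_encode_word : Primrec (Encodable.encode : List Bool → ℕ) :=
  Primrec.encode

theorem primrec_decode_word : Primrec (Encodable.decode : ℕ → Option (List Bool)) :=
  Primrec.decode

/-! ## Induced plays -/

theorem inducedHistory_eq_initSeg {C : Type} (s : List C → C) (n : ℕ) :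
    inducedHistory s n = initSeg (inducedPlay s) n := by
  induction n with
  | zero => rfl
  | succ n ih => rw [initSeg_succ, ← ih]; rfl

theorem inducedPlay_apply {C : Type} (s : List C → C) (n : ℕ) :
    inducedPlay s n = s (initSeg (inducedPlay s) n) := by
  rw [← inducedHistory_eq_initSeg]; rfl

theorem eq_inducedPlay {C : Type} {s : List C → C} {z : ℕ → C}
    (h : ∀ n, z n = s (initSeg z n)) : inducedPlay s = z := by
  have key : ∀ n, initSeg (inducedPlay s) n = initSeg z n := by
    intro n
    induction n with
    | zero => rfl
    | succ n ih => rw [initSeg_succ, initSeg_succ, ih, inducedPlay_apply, ih, ← h]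
  funext n
  rw [inducedPlay_apply, key, ← h]

/-- An agent who moves everywhere can deviate to any play. -/
theorem IsNash.not_pref_of_forall_mover {A C O : Type} {G : SequentialGame A C O} {a : A}
    (ha : ∀ u, G.mover u = a) {s : List C → C} (hs : IsNash G s) (z : ℕ → C) :
    ¬ G.pref a (G.value (inducedPlay s)) (G.value z) := by
  have := hs a fun u => z u.1.length
  rwa [eq_inducedPlay (s := deviate G s a _) (z := z)] at this
  intro n
  rw [deviate, dif_pos (ha _), initSeg_length]

theorem isNash_of_forall_mover {A C O : Type} {G : SequentialGame A C O} {a : A}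
    (ha : ∀ u, G.mover u = a) (irrefl : ∀ b x, ¬ G.pref b x x) {z : ℕ → C}
    (hz : ∀ z', ¬ G.pref a (G.value z) (G.value z')) : IsNash G fun u => z u.length := by
  have hplay : inducedPlay (fun u : List C => z u.length) = z :=
    eq_inducedPlay fun n => by rw [initSeg_length]
  intro b t
  by_cases hb : b = a
  · subst hb
    rw [hplay]
    exact hz _
  · have : deviate G (fun u : List C => z u.length) b t = fun u => z u.length := by
      funext u
      rw [deviate, dif_neg (by rw [ha]; exact fun h => hb h.symm)]
    rw [this]
    exact irrefl b _

/-! ### Cylinders and initial segments. -/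

theorem initSeg_eq_iff {α : Type*} {x y : ℕ → α} {n : ℕ} :
    initSeg x n = initSeg y n ↔ ∀ i < n, x i = y i := by
  simp [initSeg, List.map_inj_left]

theorem isOpen_cylinder (u : List Bool) : IsOpen (cylinder u) := by
  rw [isOpen_iff_forall_mem_open]
  intro x hx
  refine ⟨PiNat.cylinder x u.length, fun y hy => ?_, PiNat.isOpen_cylinder _ x _,
    PiNat.self_mem_cylinder x _⟩
  have hx : initSeg x u.length = u := hx
  change initSeg y u.length = u
  rw [← hx, initSeg_length, initSeg_eq_iff]
  exact hy

theorem isOpen_enumeratedOpen (p : ℕ → ℕ) : IsOpen (enumeratedOpen p) := by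
  have : enumeratedOpen p =
      ⋃ (n : ℕ) (u : List Bool) (_ : p n = Encodable.encode u + 1), cylinder u := by
    ext x
    simp [enumeratedOpen]
  rw [this]
  exact isOpen_iUnion fun _ => isOpen_iUnion fun u => isOpen_iUnion fun _ => isOpen_cylinder u

theorem mem_cylinder_initSeg (z : ℕ → Bool) (n : ℕ) : z ∈ cylinder (initSeg z n) := by
  simp [cylinder, initSeg_length]

theorem cylinder_eq {z : ℕ → Bool} {w : List Bool} (h : z ∈ cylinder w) :
    initSeg z w.length = w := h

theorem drop_initSeg {α : Type*} (z : ℕ → α) (n k : ℕ) :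
    (initSeg z (n + k)).drop n = initSeg (fun i => z (n + i)) k := by
  apply List.ext_getElem?
  intro i
  by_cases hi : i < k <;> simp [initSeg, hi]

/-! ## The claim game

In the claim game a single player announces for each of finitely many sequences whether it is
zero, and then chooses a point of a closed set. Only true announcements pay. -/

open Classical in
/-- The number of announcements. -/
noncomputable def numClaims (n : ℕ) (z : ℕ → Bool) : ℕ :=
  ((Finset.range n).filter fun i => z i = true).card

theorem numClaims_le (n : ℕ) (z : ℕ → Bool) : numClaims n z ≤ n := by
  simpa [numClaims] using Finset.card_filter_le (Finset.range n) fun i => z i = true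

/-- The play is admissible if all announcements are true and its tail lies in `A`. -/
def Admissible (A : Set (ℕ → Bool)) (n : ℕ) (q : ℕ → ℕ → ℕ) (z : ℕ → Bool) : Prop :=
  (fun k => z (n + k)) ∈ A ∧ ∀ i < n, z i = true → ∀ t, q i t = 0

open Classical in
/-- The payoff in the claim game. -/
noncomputable def claimValue (A : Set (ℕ → Bool)) (n : ℕ) (q : ℕ → ℕ → ℕ) (z : ℕ → Bool) : ℕ :=
  if Admissible A n q z then numClaims n z + 1 else 0

theorem claimValue_lt (A : Set (ℕ → Bool)) (n : ℕ) (q : ℕ → ℕ → ℕ) (z : ℕ → Bool) :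
    claimValue A n q z < n + 2 := by
  have := numClaims_le n z
  unfold claimValue
  split_ifs <;> omega

open Classical in
theorem numClaims_le_of_admissible {A : Set (ℕ → Bool)} {n : ℕ} {q : ℕ → ℕ → ℕ} {z : ℕ → Bool}
    (h : Admissible A n q z) :
    numClaims n z ≤ ((Finset.range n).filter fun i => ∀ t, q i t = 0).card := by
  refine Finset.card_le_card fun i hi => ?_
  rw [Finset.mem_filter, Finset.mem_range] at hi ⊢
  exact ⟨hi.1, h.2 i hi.1 hi.2⟩

open Classical in
/-- The play with all true announcements and tail `a`. -/
noncomputable def truePlay (n : ℕ) (q : ℕ → ℕ → ℕ) (a : ℕ → Bool) : ℕ → Bool :=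
  fun i => if i < n then decide (∀ t, q i t = 0) else a (i - n)

theorem admissible_truePlay {A : Set (ℕ → Bool)} {n : ℕ} {q : ℕ → ℕ → ℕ} {a : ℕ → Bool}
    (ha : a ∈ A) : Admissible A n q (truePlay n q a) := by
  refine ⟨?_, fun i hi h => ?_⟩
  · convert ha using 1
    funext k
    simp [truePlay]
  · simpa [truePlay, hi] using h

open Classical in
theorem numClaims_truePlay (n : ℕ) (q : ℕ → ℕ → ℕ) (a : ℕ → Bool) :
    numClaims n (truePlay n q a) =
      ((Finset.range n).filter fun i => ∀ t, q i t = 0).card := by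
  unfold numClaims
  congr 1
  refine Finset.filter_congr fun i hi => ?_
  simp [truePlay, Finset.mem_range.1 hi]

theorem claimValue_le_truePlay {A : Set (ℕ → Bool)} {n : ℕ} {q : ℕ → ℕ → ℕ} {a : ℕ → Bool}
    (ha : a ∈ A) (z : ℕ → Bool) : claimValue A n q z ≤ claimValue A n q (truePlay n q a) := by
  classical
  rw [claimValue, claimValue, if_pos (admissible_truePlay ha), numClaims_truePlay]
  split_ifs with h
  · exact Nat.succ_le_succ (numClaims_le_of_admissible h)
  · exact Nat.zero_le _

/-- The comparison play has positive payoff, so `z` is admissible. Its announcements are then a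
subset of the true ones of at least the same cardinality, hence all of them. -/
theorem admissible_of_claimValue_ge {A : Set (ℕ → Bool)} {n : ℕ} {q : ℕ → ℕ → ℕ}
    {a : ℕ → Bool} (ha : a ∈ A) {z : ℕ → Bool}
    (h : claimValue A n q (truePlay n q a) ≤ claimValue A n q z) :
    (fun k => z (n + k)) ∈ A ∧ ∀ i < n, (z i = true ↔ ∀ t, q i t = 0) := by
  classical
  rw [claimValue, claimValue, if_pos (admissible_truePlay ha), numClaims_truePlay] at h
  split_ifs at h with hz
  · refine ⟨hz.1, fun i hi => ⟨hz.2 i hi, fun hq => ?_⟩⟩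
    have hsub : (Finset.range n).filter (fun i => z i = true) ⊆
        (Finset.range n).filter fun i => ∀ t, q i t = 0 := by
      intro i hi
      rw [Finset.mem_filter, Finset.mem_range] at hi ⊢
      exact ⟨hi.1, hz.2 i hi.1 hi.2⟩
    have heq := Finset.eq_of_subset_of_card_le hsub (by
      have : numClaims n z = ((Finset.range n).filter fun i => z i = true).card := by
        unfold numClaims; congr
      omega)
    have : i ∈ (Finset.range n).filter fun i => z i = true := by
      rw [heq, Finset.mem_filter, Finset.mem_range]
      exact ⟨hi, hq⟩
    exact (Finset.mem_filter.1 this).2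
  · omega

/-! ### Low payoff is semidecidable. -/

/-- The number of sequences in the instance of `C × LPO*` named by `p`. -/
def lengthOf (p : ℕ → ℕ) : ℕ := p 1

/-- The sequences in the instance of `C × LPO*` named by `p`. -/
def sequenceOf (p : ℕ → ℕ) (i t : ℕ) : ℕ := p (2 * (Nat.pair i t + 1) + 1)

open Classical in
/-- The number of announcements in a word. -/
noncomputable def wordClaims (n : ℕ) (w : List Bool) : ℕ :=
  ((List.range n).filter fun i => w.getD i false = true).length

theorem getD_initSeg_bool (z : ℕ → Bool) {n k : ℕ} (h : k < n) :
    (initSeg z n).getD k false = z k := by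
  simp [initSeg, h]

theorem wordClaims_initSeg {n L : ℕ} (z : ℕ → Bool) (h : n ≤ L) :
    wordClaims n (initSeg z L) = numClaims n z := by
  classical
  have : (List.range n).filter (fun i => (initSeg z L).getD i false = true) =
      (List.range n).filter fun i => z i = true := by
    refine List.filter_congr fun i hi => ?_
    rw [getD_initSeg_bool z ((List.mem_range.1 hi).trans_le h)]
  unfold wordClaims numClaims
  rw [Finset.card_def, Finset.filter_val, Finset.range_val, Multiset.range, Multiset.filter_coe,
    Multiset.coe_card]
  convert congrArg List.length this

/-- On the information `u` about the instance, the payoff of all plays in the cylinder of `w` is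
seen to be less than `T`; the number `t` is the place to look at. -/
def PayoffBelow (T : ℕ) (u : List ℕ) (t : ℕ) (w : List Bool) : Prop :=
  0 < T ∧ u.getD 1 0 ≤ w.length ∧ (wordClaims (u.getD 1 0) w + 1 < T ∨
    (∃ i < u.getD 1 0, w.getD i false = true ∧ u.getD (2 * (Nat.pair i t + 1) + 1) 0 ≠ 0) ∨
    u.getD (2 * t) 0 = Encodable.encode (w.drop (u.getD 1 0)) + 1)

open Classical in
/-- The enumeration of cylinders in which the payoff is less than `T`. -/
noncomputable def payoffEnum (T : ℕ) (u : List ℕ) (j : ℕ) : ℕ :=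
  (Encodable.decode (α := List Bool) j.unpair.1).elim 0 fun w =>
    if PayoffBelow T u j.unpair.2.unpair.1 w then Encodable.encode w + 1 else 0

/-- The component `r` is padding: it enlarges the index, and with it the prefix consulted, until the
entry serving as evidence lies inside. -/
theorem payoffEnum_pair (T : ℕ) (u : List ℕ) (w : List Bool) (t r : ℕ)
    (h : PayoffBelow T u t w) :
    payoffEnum T u (Nat.pair (Encodable.encode w) (Nat.pair t r)) = Encodable.encode w + 1 := by
  simp [payoffEnum, h]

theorem payoffBelow_of_payoffEnum {T : ℕ} {u : List ℕ} {j : ℕ} {w : List Bool}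
    (h : payoffEnum T u j = Encodable.encode w + 1) : ∃ t, PayoffBelow T u t w := by
  unfold payoffEnum at h
  cases hd : Encodable.decode (α := List Bool) j.unpair.1 with
  | none => simp [hd] at h
  | some w' =>
    simp only [hd, Option.elim_some] at h
    split_ifs at h with hb
    obtain rfl : w' = w := Encodable.encode_injective (by omega)
    exact ⟨_, hb⟩

/-- Finite evidence for a low payoff is a small number of claims, a refuted claim, or a tail in a
cylinder disjoint from `A`. Unread entries default to `0`, which is never evidence, so short
prefixes do no harm. -/
theorem mem_enumeratedOpen_payoffEnum {A : Set (ℕ → Bool)} {p : ℕ → ℕ}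
    (hA : A = (enumeratedOpen fun n => p (2 * n))ᶜ) (T : ℕ) {N : ℕ → ℕ} (hN : ∀ j, j + 2 ≤ N j)
    (z : ℕ → Bool) :
    z ∈ enumeratedOpen (fun j => payoffEnum T (initSeg p (N j)) j) ↔
      claimValue A (lengthOf p) (sequenceOf p) z < T := by
  have hlen : ∀ j, (initSeg p (N j)).getD 1 0 = lengthOf p := fun j =>
    getD_initSeg p (by have := hN j; omega)
  constructor
  · rintro ⟨j, w, hj, hz⟩
    obtain ⟨t, hT, hn, hb⟩ := payoffBelow_of_payoffEnum hj
    rw [hlen] at hn hb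
    obtain ⟨L, rfl⟩ : ∃ L, w = initSeg z L := ⟨_, (cylinder_eq hz).symm⟩
    rw [initSeg_length] at hn
    unfold claimValue
    split_ifs with ha
    · rcases hb with hb | ⟨i, hi, hzi, hq⟩ | hb
      · rwa [wordClaims_initSeg z hn] at hb
      · rw [getD_initSeg_bool z (hi.trans_le hn)] at hzi
        rw [(getD_initSeg_of_ne_zero p hq).2] at hq
        exact absurd (ha.2 i hi hzi t) hq
      · have := (getD_initSeg_of_ne_zero p (by rw [hb]; omega)).2
        rw [hb] at this
        have hmem := ha.1
        rw [hA] at hmem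
        refine absurd ⟨t, _, this.symm, ?_⟩ hmem
        obtain ⟨k, rfl⟩ := Nat.exists_eq_add_of_le hn
        rw [drop_initSeg]
        exact mem_cylinder_initSeg _ _
    · exact hT
  · intro h
    have hT : 0 < T := by omega
    by_cases ha : Admissible A (lengthOf p) (sequenceOf p) z
    · rw [claimValue, if_pos ha] at h
      refine ⟨_, initSeg z (lengthOf p), payoffEnum_pair T _ _ 0 0 ⟨hT, ?_, Or.inl ?_⟩,
        mem_cylinder_initSeg _ _⟩
      · rw [hlen, initSeg_length]
      · rwa [hlen, wordClaims_initSeg z le_rfl]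
    · rw [Admissible, not_and_or] at ha
      rcases ha with ha | ha
      · rw [hA, Set.notMem_compl_iff] at ha
        obtain ⟨t, w, ht, hw⟩ := ha
        have hlt : 2 * t < N (Nat.pair (Encodable.encode (initSeg z (lengthOf p + w.length)))
            (Nat.pair t (2 * t))) := by
          refine lt_of_lt_of_le ?_ (hN _)
          have h1 := Nat.right_le_pair t (2 * t)
          have h2 := Nat.right_le_pair
            (Encodable.encode (initSeg z (lengthOf p + w.length))) (Nat.pair t (2 * t))
          omega
        refine ⟨_, initSeg z (lengthOf p + w.length),
          payoffEnum_pair T _ _ t (2 * t) ⟨hT, ?_, Or.inr (Or.inr ?_)⟩,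
          mem_cylinder_initSeg _ _⟩
        · rw [hlen, initSeg_length]; omega
        · rw [hlen, getD_initSeg p hlt, drop_initSeg, cylinder_eq hw]
          exact ht
      · push Not at ha
        obtain ⟨i, hi, hzi, t, ht⟩ := ha
        have hlt : 2 * (Nat.pair i t + 1) + 1 <
            N (Nat.pair (Encodable.encode (initSeg z (lengthOf p)))
              (Nat.pair t (2 * (Nat.pair i t + 1) + 1))) := by
          refine lt_of_lt_of_le ?_ (hN _)
          have h1 := Nat.right_le_pair t (2 * (Nat.pair i t + 1) + 1)
          have h2 := Nat.right_le_pair (Encodable.encode (initSeg z (lengthOf p)))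
            (Nat.pair t (2 * (Nat.pair i t + 1) + 1))
          omega
        refine ⟨_, initSeg z (lengthOf p),
          payoffEnum_pair T _ _ t (2 * (Nat.pair i t + 1) + 1)
            ⟨hT, ?_, Or.inr (Or.inl ⟨i, ?_, ?_, ?_⟩)⟩,
          mem_cylinder_initSeg _ _⟩
        · rw [hlen, initSeg_length]
        · rwa [hlen]
        · rwa [getD_initSeg_bool z hi]
        · rw [getD_initSeg p hlt]
          exact ht

theorem primrec_wordClaims : Primrec₂ wordClaims := by
  classical
  have hR : PrimrecRel fun (i : ℕ) (w : List Bool) => w.getD i false = true :=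
    Primrec.eq.comp ((Primrec.list_getD false).comp Primrec.snd Primrec.fst)
      (Primrec.const true)
  exact Primrec.list_length.comp
    ((PrimrecRel.listFilter hR).comp (Primrec.list_range.comp Primrec.fst) Primrec.snd)

theorem primrec_nat_pair {α : Type*} [Primcodable α] {f g : α → ℕ} (hf : Primrec f)
    (hg : Primrec g) : Primrec fun a => Nat.pair (f a) (g a) :=
  Primrec₂.natPair.comp hf hg

theorem primrec_double {α : Type*} [Primcodable α] {f : α → ℕ} (hf : Primrec f) :
    Primrec fun a => 2 * f a :=
  Primrec.nat_double.comp hf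

theorem primrec_succ {α : Type*} [Primcodable α] {f : α → ℕ} (hf : Primrec f) :
    Primrec fun a => f a + 1 :=
  Primrec.succ.comp hf

theorem primrecPred_payoffBelow {α : Type*} [Primcodable α] {T t : α → ℕ} {u : α → List ℕ}
    {w : α → List Bool} (hT : Primrec T) (hu : Primrec u) (ht : Primrec t) (hw : Primrec w) :
    PrimrecPred fun a => PayoffBelow (T a) (u a) (t a) (w a) := by
  have hn : Primrec fun a => (u a).getD 1 0 := primrec_getD hu (Primrec.const 1)
  refine (Primrec.nat_lt.comp (Primrec.const 0) hT).and
    ((Primrec.nat_le.comp hn (Primrec.list_length.comp hw)).and (PrimrecPred.or ?_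
      (PrimrecPred.or ?_ ?_)))
  · exact Primrec.nat_lt.comp (primrec_succ (primrec_wordClaims.comp hn hw)) hT
  · refine primrecPred_exists_lt hn (PrimrecPred.and ?_ (PrimrecPred.not ?_))
    · exact Primrec.eq.comp ((Primrec.list_getD false).comp (hw.comp Primrec.fst) Primrec.snd)
        (Primrec.const true)
    · exact Primrec.eq.comp (primrec_getD (hu.comp Primrec.fst) (primrec_succ (primrec_double
        (primrec_succ (primrec_nat_pair Primrec.snd (ht.comp Primrec.fst))))))
        (Primrec.const 0)
  · exact Primrec.eq.comp (primrec_getD hu (primrec_double ht))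
      (primrec_succ (primrec_encode_word.comp (Primrec.list_drop.comp hn hw)))

theorem primrec_elim_zero {α β : Type*} [Primcodable α] [Primcodable β] {f : α → Option β}
    {g : α → β → ℕ} (hf : Primrec f) (hg : Primrec₂ g) :
    Primrec fun a => (f a).elim 0 (g a) :=
  (Primrec.option_casesOn hf (Primrec.const 0) hg).of_eq fun a => by cases f a <;> rfl

theorem primrec_unpair_fst {α : Type*} [Primcodable α] {f : α → ℕ} (hf : Primrec f) :
    Primrec fun a => (f a).unpair.1 :=
  Primrec.fst.comp (Primrec.unpair.comp hf)

theorem primrec_unpair_snd {α : Type*} [Primcodable α] {f : α → ℕ} (hf : Primrec f) :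
    Primrec fun a => (f a).unpair.2 :=
  Primrec.snd.comp (Primrec.unpair.comp hf)

open Classical in
theorem primrec_payoffEnum {α : Type*} [Primcodable α] {T j : α → ℕ} {u : α → List ℕ}
    (hT : Primrec T) (hu : Primrec u) (hj : Primrec j) :
    Primrec fun a => payoffEnum (T a) (u a) (j a) :=
  primrec_elim_zero (primrec_decode_word.comp (primrec_unpair_fst hj))
    (Primrec.ite (primrecPred_payoffBelow (hT.comp Primrec.fst) (hu.comp Primrec.fst)
        (primrec_unpair_fst (primrec_unpair_snd (hj.comp Primrec.fst))) Primrec.snd)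
      (primrec_succ (primrec_encode_word.comp Primrec.snd)) (Primrec.const 0))

/-! ### The claim game and its name. -/

/-- The claim game for a closed set `A` and sequences `q 0, …, q (n - 1)`: player `0` makes all
choices and maximizes his payoff. -/
noncomputable def claimSequentialGame (A : Set (ℕ → Bool)) (n : ℕ) (q : ℕ → ℕ → ℕ) :
    SequentialGame (Fin 2) Bool (Fin (n + 2)) where
  mover _ := 0
  value z := ⟨claimValue A n q z, claimValue_lt A n q z⟩
  pref i x y := if i = 0 then x < y else y < x

theorem isOpen_claimValue_lt {A : Set (ℕ → Bool)} {p : ℕ → ℕ}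
    (hA : A = (enumeratedOpen fun n => p (2 * n))ᶜ) (T : ℕ) :
    IsOpen {z | claimValue A (lengthOf p) (sequenceOf p) z < T} := by
  have := isOpen_enumeratedOpen fun j => payoffEnum T (initSeg p (j + 2)) j
  convert this using 1
  ext z
  exact (mem_enumeratedOpen_payoffEnum hA T (fun _ => le_rfl) z).symm

/-- The claim game for the instance of `C × LPO*` named by `p`. -/
noncomputable def claimGame (A : Set (ℕ → Bool)) (p : ℕ → ℕ)
    (hA : A = (enumeratedOpen fun n => p (2 * n))ᶜ) : AntagonisticGame where
  numOutcomes := lengthOf p + 2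
  game := claimSequentialGame A (lengthOf p) (sequenceOf p)
  pref_irrefl i x := by simp [claimSequentialGame]
  pref_trans i x y z := by
    simp only [claimSequentialGame]
    split_ifs
    · exact lt_trans
    · exact fun h h' => lt_trans h' h
  pref_total i x y := by
    simp only [claimSequentialGame]
    split_ifs
    · exact lt_trichotomy x y
    · rcases lt_trichotomy x y with h | h | h <;> simp [h]
  antagonistic x y := by simp [claimSequentialGame]
  upper_openOrClosed i S hS := by
    by_cases hi : i = 0
    · refine Or.inr ?_
      have : (claimSequentialGame A (lengthOf p) (sequenceOf p)).value ⁻¹' S =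
          ⋃ x ∈ S, {z | claimValue A (lengthOf p) (sequenceOf p) z < (x : ℕ)}ᶜ := by
        ext z
        simp only [Set.mem_preimage, Set.mem_iUnion, exists_prop, Set.mem_compl_iff,
          Set.mem_ofPred_eq, not_lt]
        refine ⟨fun h => ⟨_, h, le_rfl⟩, ?_⟩
        rintro ⟨x, hx, hle⟩
        rcases hle.lt_or_eq with h | h
        · exact hS x _ hx (by simp only [claimSequentialGame, hi, if_true]; exact h)
        · rwa [show x = (claimSequentialGame A (lengthOf p) (sequenceOf p)).value z from
            Fin.ext h] at hx
      rw [this]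
      exact (Set.toFinite S).isClosed_biUnion fun x _ =>
        (isOpen_claimValue_lt hA x).isClosed_compl
    · refine Or.inl ?_
      have : (claimSequentialGame A (lengthOf p) (sequenceOf p)).value ⁻¹' S =
          ⋃ x ∈ S, {z | claimValue A (lengthOf p) (sequenceOf p) z < (x : ℕ) + 1} := by
        ext z
        simp only [Set.mem_preimage, Set.mem_iUnion, exists_prop, Set.mem_ofPred_eq]
        refine ⟨fun h => ⟨_, h, Nat.lt_succ_self _⟩, ?_⟩
        rintro ⟨x, hx, hle⟩
        rcases (Nat.lt_succ_iff.1 hle).lt_or_eq with h | h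
        · exact hS x _ hx (by simp only [claimSequentialGame, hi, if_false]; exact h)
        · rwa [show x = (claimSequentialGame A (lengthOf p) (sequenceOf p)).value z from
            Fin.ext h.symm] at hx
      rw [this]
      exact isOpen_biUnion fun x _ => isOpen_claimValue_lt hA _

open Classical in
/-- The value at position `Nat.pair c j` of the name of the claim game, computed from the
information `u` about the instance. -/
noncomputable def claimGameEntry (u : List ℕ) (c j : ℕ) : ℕ :=
  if c = 0 then u.getD 1 0 + 2 else
  if c = 1 then 0 else
  if c = 2 then
    if (j.unpair.1 = 0 ∧ j.unpair.2.unpair.1 < j.unpair.2.unpair.2) ∨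
        (j.unpair.1 = 1 ∧ j.unpair.2.unpair.2 < j.unpair.2.unpair.1) then 1 else 0 else
  if j = 0 then 1 - (c - 3).unpair.1 else
    payoffEnum ((c - 3).unpair.1 + (c - 3).unpair.2) u (j - 1)

/-- The value of the name of the claim game computed from a prefix of the name of an instance. -/
noncomputable def claimGameOfPrefix (u : List ℕ) : ℕ :=
  claimGameEntry u (u.length - 2).unpair.1 (u.length - 2).unpair.2

theorem primrec_claimGameOfPrefix : Primrec claimGameOfPrefix := by
  classical
  have hm : Primrec fun u : List ℕ => u.length - 2 :=
    Primrec.nat_sub.comp Primrec.list_length (Primrec.const 2)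
  have hc := primrec_unpair_fst hm
  have hj := primrec_unpair_snd hm
  have h3 : Primrec fun u : List ℕ => (u.length - 2).unpair.1 - 3 :=
    Primrec.nat_sub.comp hc (Primrec.const 3)
  have hj1 := primrec_unpair_fst hj
  have hj2 := primrec_unpair_fst (primrec_unpair_snd hj)
  have hj3 := primrec_unpair_snd (primrec_unpair_snd hj)
  refine Primrec.ite (Primrec.eq.comp hc (Primrec.const 0))
    (primrec_succ (primrec_succ (primrec_getD Primrec.id (Primrec.const 1)))) ?_
  refine Primrec.ite (Primrec.eq.comp hc (Primrec.const 1)) (Primrec.const 0) ?_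
  refine Primrec.ite (Primrec.eq.comp hc (Primrec.const 2)) (Primrec.ite
    (((Primrec.eq.comp hj1 (Primrec.const 0)).and (Primrec.nat_lt.comp hj2 hj3)).or
      ((Primrec.eq.comp hj1 (Primrec.const 1)).and (Primrec.nat_lt.comp hj3 hj2)))
      (Primrec.const 1) (Primrec.const 0)) ?_
  exact Primrec.ite (Primrec.eq.comp hj (Primrec.const 0))
    (Primrec.nat_sub.comp (Primrec.const 1) (primrec_unpair_fst h3))
    (primrec_payoffEnum
      (Primrec.nat_add.comp (primrec_unpair_fst h3) (primrec_unpair_snd h3)) Primrec.id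
      (Primrec.nat_sub.comp hj (Primrec.const 1)))

theorem col_prefixFun_claimGameOfPrefix (p : ℕ → ℕ) (c j : ℕ) :
    col (prefixFun claimGameOfPrefix p) c j =
      claimGameEntry (initSeg p (Nat.pair c j + 2)) c j := by
  simp [col, prefixFun, claimGameOfPrefix, initSeg_length]

/-- For player `0` the upper set of `x` is closed with complement `payoff < x`; for player `1` it is
the open set `payoff < x + 1`. This accounts for the tag `1 - i` and the threshold `i + x`. -/
theorem isName_claimGame (A : Set (ℕ → Bool)) (p : ℕ → ℕ)
    (hA : A = (enumeratedOpen fun n => p (2 * n))ᶜ) :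
    (claimGame A p hA).IsName (prefixFun claimGameOfPrefix p) := by
  refine ⟨?_, fun u => ?_, fun i x y => ?_, fun i x => ?_⟩
  · rw [col_prefixFun_claimGameOfPrefix, claimGameEntry, if_pos rfl, getD_initSeg p (by omega)]
    rfl
  · rw [col_prefixFun_claimGameOfPrefix]
    simp [claimGameEntry, claimGame, claimSequentialGame]
  · rw [col_prefixFun_claimGameOfPrefix]
    by_cases h : (claimGame A p hA).game.pref i x y
    all_goals
      have h' := h
      simp only [claimGame, claimSequentialGame, Fin.lt_def] at h'
    · refine Or.inl ⟨h, ?_⟩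
      fin_cases i
      · simpa [claimGameEntry] using h'
      · simpa [claimGameEntry] using h'
    · refine Or.inr ⟨h, ?_⟩
      fin_cases i
      · simpa [claimGameEntry] using h'
      · simpa [claimGameEntry] using h'
  · have tag : col (prefixFun claimGameOfPrefix p) (Nat.pair i x + 3) 0 = 1 - i := by
      rw [col_prefixFun_claimGameOfPrefix]
      simp [claimGameEntry]
    have enum : (fun j => col (prefixFun claimGameOfPrefix p) (Nat.pair i x + 3) (j + 1)) =
        fun j => payoffEnum (i + x)
          (initSeg p (Nat.pair (Nat.pair i x + 3) (j + 1) + 2)) j := by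
      funext j
      rw [col_prefixFun_claimGameOfPrefix]
      simp [claimGameEntry]
    have hN : ∀ j, j + 2 ≤ Nat.pair (Nat.pair i x + 3) (j + 1) + 2 := fun j => by
      have := Nat.right_le_pair (Nat.pair i x + 3) (j + 1)
      omega
    have hmem := mem_enumeratedOpen_payoffEnum hA (i + x) hN
    by_cases hi : i = 0
    · refine Or.inr ⟨by rw [tag, hi]; rfl, ?_⟩
      ext z
      rw [enum, Set.mem_compl_iff, hmem z]
      have : z ∈ ((claimGame A p hA).upperPlays i x).1 ↔
          (x : ℕ) = claimValue A (lengthOf p) (sequenceOf p) z ∨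
            (x : ℕ) < claimValue A (lengthOf p) (sequenceOf p) z := by
        subst hi
        exact or_congr Fin.ext_iff Iff.rfl
      rw [this, hi, Fin.val_zero]
      omega
    · obtain rfl : i = 1 := by omega
      refine Or.inl ⟨by rw [tag]; rfl, ?_⟩
      ext z
      rw [enum, hmem z]
      have : z ∈ ((claimGame A p hA).upperPlays 1 x).1 ↔
          (x : ℕ) = claimValue A (lengthOf p) (sequenceOf p) z ∨
            claimValue A (lengthOf p) (sequenceOf p) z < (x : ℕ) := by
        exact or_congr Fin.ext_iff Iff.rfl
      rw [this, Fin.val_one]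
      omega

/-! ## Reading off a solution from an equilibrium of the claim game -/

/-- The induced history of length `k` of the profile whose name is given in the odd positions of
`u`. -/
def historyOfWord (u : List ℕ) : ℕ → Option (List Bool)
  | 0 => some []
  | k + 1 => (historyOfWord u k).bind fun w =>
      (u[2 * Encodable.encode w + 1]?).map fun v => w ++ [decide (v = 1)]

/-- The move at time `k` of the profile whose name is given in the odd positions of `u`. -/
def moveOfWord (u : List ℕ) (k : ℕ) : Option ℕ :=
  (historyOfWord u k).bind fun w => u[2 * Encodable.encode w + 1]?

theorem primrec_historyOfWord : Primrec₂ historyOfWord := by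
  have hu : Primrec fun a : (List ℕ × (ℕ × Option (List Bool))) × List Bool =>
      (a.1.1)[2 * Encodable.encode a.2 + 1]? :=
    Primrec.list_getElem?.comp (Primrec.fst.comp Primrec.fst)
      (primrec_succ (primrec_double (primrec_encode_word.comp Primrec.snd)))
  have hv : Primrec₂ fun (a : (List ℕ × (ℕ × Option (List Bool))) × List Bool) (v : ℕ) =>
      a.2 ++ [decide (v = 1)] :=
    Primrec.list_concat.comp (Primrec.snd.comp Primrec.fst)
      (PrimrecPred.decide (Primrec.eq.comp Primrec.snd (Primrec.const 1)))
  have step : Primrec₂ fun (u : List ℕ) (s : ℕ × Option (List Bool)) =>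
      s.2.bind fun w => (u[2 * Encodable.encode w + 1]?).map fun v => w ++ [decide (v = 1)] :=
    Primrec.option_bind (Primrec.snd.comp Primrec.snd) (Primrec.option_map hu hv)
  refine (Primrec.nat_rec (Primrec.const (some [])) step).of_eq fun u k => ?_
  induction k with
  | zero => rfl
  | succ k ih => simp only [historyOfWord, ← ih]

theorem primrec_moveOfWord {α : Type*} [Primcodable α] {u : α → List ℕ} {k : α → ℕ}
    (hu : Primrec u) (hk : Primrec k) : Primrec fun a => moveOfWord (u a) (k a) :=
  Primrec.option_bind (primrec_historyOfWord.comp hu hk)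
    (Primrec.list_getElem?.comp (hu.comp Primrec.fst)
      (primrec_succ (primrec_double (primrec_encode_word.comp Primrec.snd))))

theorem getElem?_initSeg_eq_some {α : Type*} {p : ℕ → α} {n k : ℕ} {v : α}
    (h : (initSeg p n)[k]? = some v) : v = p k := by
  by_cases hk : k < n
  · rw [getElem?_initSeg p hk] at h
    exact (Option.some.inj h).symm
  · simp [initSeg, hk] at h

theorem historyOfWord_eq_some {p : ℕ → ℕ} {s : List Bool → Bool}
    (hs : ∀ w : List Bool, p (2 * Encodable.encode w + 1) = (s w).toNat) {n k : ℕ} {w : List Bool}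
    (h : historyOfWord (initSeg p n) k = some w) : w = inducedHistory s k := by
  induction k generalizing w with
  | zero => simpa [historyOfWord, inducedHistory] using h.symm
  | succ k ih =>
    simp only [historyOfWord, Option.bind_eq_some_iff, Option.map_eq_some_iff] at h
    obtain ⟨w', hw', v, hv, rfl⟩ := h
    obtain rfl := ih hw'
    rw [getElem?_initSeg_eq_some hv, hs, inducedHistory]
    cases s (inducedHistory s k) <;> rfl

theorem moveOfWord_eq_some {p : ℕ → ℕ} {s : List Bool → Bool}
    (hs : ∀ w : List Bool, p (2 * Encodable.encode w + 1) = (s w).toNat) {n k v : ℕ}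
    (h : moveOfWord (initSeg p n) k = some v) : v = (inducedPlay s k).toNat := by
  obtain ⟨w, hw, hv⟩ := Option.bind_eq_some_iff.1 h
  obtain rfl := historyOfWord_eq_some hs hw
  rw [getElem?_initSeg_eq_some hv, hs]
  rfl

theorem exists_moveOfWord_isSome {p : ℕ → ℕ} {s : List Bool → Bool}
    (hs : ∀ w : List Bool, p (2 * Encodable.encode w + 1) = (s w).toNat) (k : ℕ) :
    ∃ N, ∀ n ≥ N, (moveOfWord (initSeg p n) k).isSome := by
  have key : ∀ k, ∃ N, ∀ n ≥ N, (historyOfWord (initSeg p n) k).isSome := by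
    intro k
    induction k with
    | zero => exact ⟨0, fun _ _ => rfl⟩
    | succ k ih =>
      obtain ⟨N, hN⟩ := ih
      refine ⟨max N (2 * Encodable.encode (inducedHistory s k) + 2), fun n hn => ?_⟩
      obtain ⟨w, hw⟩ := Option.isSome_iff_exists.1 (hN n (le_of_max_le_left hn))
      have hlt := le_of_max_le_right hn
      have hw' := historyOfWord_eq_some hs hw
      rw [← hw'] at hlt
      rw [historyOfWord, hw, Option.bind_some, getElem?_initSeg p (by omega)]
      rfl
  obtain ⟨N, hN⟩ := key k
  refine ⟨max N (2 * Encodable.encode (inducedHistory s k) + 2), fun n hn => ?_⟩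
  obtain ⟨w, hw⟩ := Option.isSome_iff_exists.1 (hN n (le_of_max_le_left hn))
  have hlt := le_of_max_le_right hn
  rw [← historyOfWord_eq_some hs hw] at hlt
  rw [moveOfWord, hw, Option.bind_some, getElem?_initSeg p (by omega)]
  rfl

/-- The solution of the instance of `C × LPO*`, computed from a word of the pair of the instance
and an equilibrium of its claim game. -/
def claimSolution (u : List ℕ) (m : ℕ) : Option ℕ :=
  u[2]?.bind fun n =>
    if m % 2 = 0 then moveOfWord u (n + m / 2) else
    if m = 1 then some n else moveOfWord u ((m - 3) / 2).unpair.1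

theorem primrec_claimSolution : Primrec₂ claimSolution := by
  have hu : Primrec fun a : (List ℕ × ℕ) × ℕ => a.1.1 := Primrec.fst.comp Primrec.fst
  have hm : Primrec fun a : (List ℕ × ℕ) × ℕ => a.1.2 := Primrec.snd.comp Primrec.fst
  refine Primrec.option_bind (Primrec.list_getElem?.comp Primrec.fst (Primrec.const 2)) ?_
  refine Primrec.ite
    (Primrec.eq.comp (Primrec.nat_mod.comp hm (Primrec.const 2)) (Primrec.const 0))
    (primrec_moveOfWord hu
      (Primrec.nat_add.comp Primrec.snd (Primrec.nat_div.comp hm (Primrec.const 2)))) ?_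
  exact Primrec.ite (Primrec.eq.comp hm (Primrec.const 1))
    (Primrec.option_some.comp Primrec.snd)
    (primrec_moveOfWord hu (primrec_unpair_fst (Primrec.nat_div.comp
      (Primrec.nat_sub.comp hm (Primrec.const 3)) (Primrec.const 2))))

/-- Entry `2` of the pair is entry `1` of the instance, the number of sequences. In the output, even
positions hold the tail of the play, position `1` the length, and position `2 * (⟨i, k⟩ + 1) + 1`
the `i`-th answer, whence `(m - 3) / 2`. -/
theorem approximates_claimSolution {p : ℕ → ℕ} {s : List Bool → Bool}
    (hs : ∀ w : List Bool, p (2 * Encodable.encode w + 1) = (s w).toNat) :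
    Approximates claimSolution p fun m =>
      if m % 2 = 0 then (inducedPlay s (p 2 + m / 2)).toNat else
      if m = 1 then p 2 else (inducedPlay s ((m - 3) / 2).unpair.1).toNat := by
  refine ⟨fun k m v h => ?_, fun m => ?_⟩
  · obtain ⟨n, hn, h⟩ := Option.bind_eq_some_iff.1 h
    obtain rfl := getElem?_initSeg_eq_some hn
    dsimp only
    split_ifs at h ⊢
    · exact moveOfWord_eq_some hs h
    · exact (Option.some.inj h).symm
    · exact moveOfWord_eq_some hs h
  · obtain ⟨N, hN⟩ := exists_moveOfWord_isSome hs (p 2 + m / 2)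
    obtain ⟨M, hM⟩ := exists_moveOfWord_isSome hs ((m - 3) / 2).unpair.1
    refine ⟨max 3 (max N M), fun k hk => ?_⟩
    have h3 : 2 < k := le_of_max_le_left hk
    have hk' := le_of_max_le_right hk
    rw [claimSolution, getElem?_initSeg p h3, Option.bind_some]
    split_ifs
    · exact hN k (le_of_max_le_left hk')
    · rfl
    · exact hM k (le_of_max_le_right hk')

theorem pairSeq_even (p q : ℕ → ℕ) (n : ℕ) : pairSeq p q (2 * n) = p n := by
  simp [pairSeq]

theorem pairSeq_odd (p q : ℕ → ℕ) (n : ℕ) : pairSeq p q (2 * n + 1) = q n := by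
  have h1 : (2 * n + 1) % 2 = 1 := by omega
  have h2 : (2 * n + 1) / 2 = n := by omega
  simp [pairSeq, h1, h2]

theorem claimGame_nash {A : Set (ℕ → Bool)} {p : ℕ → ℕ}
    (hA : A = (enumeratedOpen fun n => p (2 * n))ᶜ) {a : ℕ → Bool} (ha : a ∈ A)
    {s : List Bool → Bool} (hs : IsNash (claimGame A p hA).game s) :
    (fun k => inducedPlay s (lengthOf p + k)) ∈ A ∧
      ∀ i < lengthOf p, (inducedPlay s i = true ↔ ∀ t, sequenceOf p i t = 0) := by
  have h := hs.not_pref_of_forall_mover (a := 0) (fun _ => rfl)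
    (truePlay (lengthOf p) (sequenceOf p) a)
  refine admissible_of_claimValue_ge ha ?_
  simpa [claimGame, claimSequentialGame] using h

theorem claimGame_exists_nash {A : Set (ℕ → Bool)} {p : ℕ → ℕ}
    (hA : A = (enumeratedOpen fun n => p (2 * n))ᶜ) {a : ℕ → Bool} (ha : a ∈ A) :
    (findNash (claimGame A p hA)).Nonempty := by
  refine ⟨_, isNash_of_forall_mover (a := 0) (fun _ => rfl) (claimGame A p hA).pref_irrefl
    (z := truePlay (lengthOf p) (sequenceOf p) a) fun z' => ?_⟩
  have := claimValue_le_truePlay (n := lengthOf p) (q := sequenceOf p) ha z'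
  simpa [claimGame, claimSequentialGame] using this

theorem prod_star_reducible_findNash :
    Reducible (prod closedChoiceCantor (star LPO)) findNash := by
  refine ⟨approxFun claimSolution, fun p => Part.some (prefixFun claimGameOfPrefix p),
    computableOnBaire_approxFun primrec_claimSolution,
    computableOnBaire_prefixFun primrec_claimGameOfPrefix, fun G hG => ?_⟩
  rintro p ⟨A, n, x⟩ ⟨hA, hn, hx⟩ ⟨⟨a, _⟩, ha, _⟩
  change (A : Set (ℕ → Bool)) = (enumeratedOpen fun n => p (2 * n))ᶜ at hA
  change p 1 = n at hn
  subst hn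
  obtain ⟨r, hr, s, hs, hrs⟩ := hG _ _ (isName_claimGame A p hA) (claimGame_exists_nash hA ha)
  obtain ⟨h1, h2⟩ := claimGame_nash hA ha hs
  have happ := approximates_claimSolution (p := pairSeq p r) (s := s) fun w => by
    rw [pairSeq_odd]; exact hrs w
  refine ⟨_, Part.mem_bind (Part.mem_some _) (Part.mem_bind hr (mem_approxFun.2 happ)),
    ⟨fun k => inducedPlay s (p 1 + k), ⟨p 1, fun i => inducedPlay s i⟩⟩,
    ⟨h1, fun i => inducedPlay s i, fun i => ?_, rfl⟩, fun k => ?_, ?_, fun i => ?_⟩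
  · have : x i = sequenceOf p i := (hx i).symm
    change _ = true ↔ ∀ t, x i t = 0
    rw [this]
    exact h2 i i.2
  · have := pairSeq_even p r 1
    simp [this]
  · simpa using pairSeq_even p r 1
  · change (if (2 * (Nat.pair i 0 + 1) + 1) % 2 = 0 then _ else _) = _
    have h4 : (2 * (Nat.pair i 0 + 1) + 1) % 2 ≠ 0 := by omega
    have h5 : 2 * (Nat.pair i 0 + 1) + 1 ≠ 1 := by omega
    have h6 : (2 * (Nat.pair i 0 + 1) + 1 - 3) / 2 = Nat.pair i 0 := by omega
    rw [if_neg h4, if_neg h5, h6, Nat.unpair_pair]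

/-! ## Nash equilibria from strategies for all win-lose games -/

/-- The play `z` follows the profile `s` wherever agent `a` moves. -/
def Follows {A C O : Type} (G : SequentialGame A C O) (a : A) (s : List C → C) (z : ℕ → C) :
    Prop :=
  ∀ k, G.mover (initSeg z k) = a → z k = s (initSeg z k)

theorem follows_inducedPlay {A C O : Type} (G : SequentialGame A C O) (a : A) (s : List C → C) :
    Follows G a s (inducedPlay s) :=
  fun k _ => inducedPlay_apply s k

theorem follows_deviate {A C O : Type} (G : SequentialGame A C O) {a b : A} (hab : a ≠ b)
    (s : List C → C) (t : {u : List C // G.mover u = b} → C) :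
    Follows G a s (inducedPlay (deviate G s b t)) := by
  intro k hk
  rw [inducedPlay_apply (deviate G s b t), deviate, dif_neg]
  exact fun h => hab (hk.symm.trans h)

theorem Follows.congr {A C O : Type} {G : SequentialGame A C O} {a : A} {s s' : List C → C}
    (h : ∀ w, G.mover w = a → s w = s' w) {z : ℕ → C} (hz : Follows G a s z) :
    Follows G a s' z :=
  fun k hk => (hz k hk).trans (h _ hk)

theorem AntagonisticGame.exists_maximal (G : AntagonisticGame) (i : Fin 2)
    {P : Fin G.numOutcomes → Prop} (h : ∃ x, P x) :
    ∃ x, P x ∧ ∀ y, P y → y = x ∨ G.game.pref i y x := by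
  have htrans : IsTrans (Fin G.numOutcomes) fun x y => G.game.pref i y x :=
    ⟨fun x y z hxy hyz => G.pref_trans i _ _ _ hyz hxy⟩
  have hirrefl : Std.Irrefl (α := Fin G.numOutcomes) fun x y => G.game.pref i y x :=
    ⟨fun x => G.pref_irrefl i x⟩
  have wf := Finite.wellFounded_of_trans_of_irrefl fun x y : Fin G.numOutcomes => G.game.pref i y x
  obtain ⟨x, hx, hmin⟩ := wf.has_min {x | P x} h
  refine ⟨x, hx, fun y hy => ?_⟩
  rcases G.pref_total i y x with h | h | h
  · exact Or.inr h
  · exact Or.inl h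
  · exact absurd h (hmin y hy)

/-- If for every outcome one of the players can decide the game about reaching this outcome or a
better one, and both players play for the best outcome they can enforce, then this is a Nash
equilibrium. -/
theorem AntagonisticGame.isNash_of_win (G : AntagonisticGame) {win : Fin G.numOutcomes → Prop}
    {str : Fin G.numOutcomes → List Bool → Bool}
    (hwin : ∀ x, win x → ∀ z, Follows G.game 0 (str x) z → z ∈ (G.upperPlays 0 x).1)
    (hlose : ∀ x, ¬ win x → ∀ z, Follows G.game 1 (str x) z → z ∉ (G.upperPlays 0 x).1)
    {s : List Bool → Bool}
    (h0 : (∃ x, win x ∧ ∀ y, win y → y = x ∨ G.game.pref 0 y x) →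
      ∃ x, (win x ∧ ∀ y, win y → y = x ∨ G.game.pref 0 y x) ∧
        ∀ w, G.game.mover w = 0 → s w = str x w)
    (h1 : (∃ x, ¬ win x ∧ ∀ y, ¬ win y → y = x ∨ G.game.pref 1 y x) →
      ∃ x, (¬ win x ∧ ∀ y, ¬ win y → y = x ∨ G.game.pref 1 y x) ∧
        ∀ w, G.game.mover w = 1 → s w = str x w) :
    IsNash G.game s := by
  have asymm : ∀ x y, G.game.pref 0 x y → ¬ G.game.pref 0 y x := fun x y h h' =>
    G.pref_irrefl 0 _ (G.pref_trans 0 _ _ _ h h')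
  -- For player `1`'s favourite outcome, player `0`'s upper set contains every play, so player `1`
  -- cannot avoid it.
  have exists_win : ∃ x, win x := by
    obtain ⟨x, -, hx⟩ := G.exists_maximal 1 (P := fun _ => True)
      ⟨G.game.value fun _ => false, trivial⟩
    by_contra! hno
    refine hlose x (hno x) _ (follows_inducedPlay G.game 1 (str x)) ?_
    rcases hx (G.game.value (inducedPlay (str x))) trivial with h | h
    · exact Or.inl h.symm
    · exact Or.inr ((G.antagonistic _ _).2 h)
  obtain ⟨x, ⟨hx, hmax⟩, hsx⟩ := h0 (G.exists_maximal 0 exists_win)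
  have lower : ∀ z, Follows G.game 0 s z → x = G.game.value z ∨ G.game.pref 0 x (G.game.value z) :=
    fun z hz => hwin x hx z (hz.congr hsx)
  -- A value that player `0` cannot enforce is, for him, at least as good as player `1`'s target
  -- `y`, and player `1`'s strategy excludes just such values.
  have upper : ∀ z, Follows G.game 1 s z →
      G.game.value z = x ∨ G.game.pref 0 (G.game.value z) x := by
    intro z hz
    by_cases hv : win (G.game.value z)
    · exact hmax _ hv
    · obtain ⟨y, ⟨hy, hmin⟩, hsy⟩ := h1 (G.exists_maximal 1 ⟨_, hv⟩)
      have := hlose y hy z (hz.congr hsy)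
      refine absurd ?_ this
      rcases hmin _ hv with h | h
      · exact Or.inl h.symm
      · exact Or.inr ((G.antagonistic _ _).2 h)
  have value_eq : G.game.value (inducedPlay s) = x := by
    rcases lower _ (follows_inducedPlay G.game 0 s) with h | h
    · exact h.symm
    · rcases upper _ (follows_inducedPlay G.game 1 s) with h' | h'
      · exact h'
      · exact absurd h' (asymm _ _ h)
  intro a t
  rw [value_eq]
  intro hpref
  by_cases ha : a = 0
  · subst ha
    rcases upper _ (follows_deviate G.game one_ne_zero s t) with h | h
    · rw [h] at hpref
      exact G.pref_irrefl _ _ hpref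
    · exact asymm _ _ h hpref
  · obtain rfl : a = 1 := by omega
    have hpref := (G.antagonistic _ _).2 hpref
    rcases lower _ (follows_deviate G.game zero_ne_one s t) with h | h
    · rw [← h] at hpref
      exact G.pref_irrefl _ _ hpref
    · exact asymm _ _ h hpref

/-! ## Certificates for open games -/

/-- The position, in the name of a game, of the entry `k` of the name of the set of plays that lead
to the outcome `x` or a better one for player `0`. -/
def outcomeIdx (x k : ℕ) : ℕ := Nat.pair (Nat.pair 0 x + 3) k

/-- The position, in the name of a game, of the player who moves at `w`. -/
def moverIdx (w : List Bool) : ℕ := Nat.pair 1 (Encodable.encode w)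

/-- According to the information `U` about the game, the enumeration for the outcome `x` contains
the cylinder of some prefix of `v`. -/
def Covered (U : List ℕ) (x : ℕ) (v : List Bool) : Prop :=
  ∃ j < v.length + 1, ∃ k < U.length,
    U.getD (outcomeIdx x (k + 1)) 0 = Encodable.encode (v.take j) + 1

/-- The information `U` suffices to see who moves at `v` and who wants to enter the enumerated
open set for the outcome `x`. -/
def Known (U : List ℕ) (x : ℕ) (v : List Bool) : Prop :=
  outcomeIdx x 0 < U.length ∧ moverIdx v < U.length

/-- The player who moves at `v` is the one who wants to enter the enumerated open set. -/
def OpenMoves (U : List ℕ) (x : ℕ) (v : List Bool) : Prop :=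
  U.getD (outcomeIdx x 0) 0 = U.getD (moverIdx v) 0

/-- The condition on the words `v` in a certificate `S`. -/
def CertStep (U : List ℕ) (x : ℕ) (S : List (List Bool)) (v : List Bool) : Prop :=
  Covered U x v ∨ (v ++ [false] ∈ S ∧ v ++ [true] ∈ S) ∨
    ((v ++ [false] ∈ S ∨ v ++ [true] ∈ S) ∧ Known U x v ∧ OpenMoves U x v)

/-- The certificate with number `s`. -/
def certOfNat (s : ℕ) : List (List Bool) := (Encodable.decode s).getD []

theorem certOfNat_encode (S : List (List Bool)) : certOfNat (Encodable.encode S) = S := by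
  simp [certOfNat]

/-- The information `U` and some small certificate show that the open player wins from `w`. -/
def Certified (U : List ℕ) (x : ℕ) (w : List Bool) : Prop :=
  ∃ s < U.length, w ∈ certOfNat s ∧ ∀ v ∈ certOfNat s, CertStep U x (certOfNat s) v

/-! ### Growth and composition of certificates. -/

section

variable {p : ℕ → ℕ} {x : ℕ}

theorem Covered.mono {t t' : ℕ} (h : t ≤ t') {v : List Bool} (hv : Covered (initSeg p t) x v) :
    Covered (initSeg p t') x v := by
  obtain ⟨j, hj, k, hk, e⟩ := hv
  rw [initSeg_length] at hk
  obtain ⟨hlt, e'⟩ := getD_initSeg_of_ne_zero p (k := outcomeIdx x (k + 1)) (by rw [e]; omega)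
  refine ⟨j, hj, k, by rw [initSeg_length]; omega, ?_⟩
  rw [getD_initSeg p (by omega), ← e', e]

theorem Known.mono {t t' : ℕ} (h : t ≤ t') {v : List Bool} (hv : Known (initSeg p t) x v) :
    Known (initSeg p t') x v := by
  simp only [Known, initSeg_length] at hv ⊢
  omega

/-- The tag doubles as the number of the open player: with tag `0` the set itself is enumerated and
player `0` wants to enter it, with tag `1` its complement is and player `1` does. Once both entries
are read, the comparison is independent of the stage. -/
theorem Known.openMoves_iff {t : ℕ} {v : List Bool} (hv : Known (initSeg p t) x v) :
    OpenMoves (initSeg p t) x v ↔ p (outcomeIdx x 0) = p (moverIdx v) := by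
  simp only [Known, initSeg_length] at hv
  rw [OpenMoves, getD_initSeg p hv.1, getD_initSeg p hv.2]

theorem exists_known (p : ℕ → ℕ) (x : ℕ) (v : List Bool) : ∃ t, Known (initSeg p t) x v :=
  ⟨outcomeIdx x 0 + moverIdx v + 1, by simp only [Known, initSeg_length]; omega⟩

theorem CertStep.mono {t t' : ℕ} (h : t ≤ t') {S S' : List (List Bool)} (hS : S ⊆ S')
    {v : List Bool} (hv : CertStep (initSeg p t) x S v) : CertStep (initSeg p t') x S' v := by
  rcases hv with hv | hv | ⟨hv, hk, ho⟩
  · exact Or.inl (hv.mono h)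
  · exact Or.inr (Or.inl (hv.imp (fun h => hS h) fun h => hS h))
  · refine Or.inr (Or.inr ⟨hv.imp (fun h => hS h) fun h => hS h, hk.mono h, ?_⟩)
    rwa [(hk.mono h).openMoves_iff, ← hk.openMoves_iff]

theorem Certified.mono {t t' : ℕ} (h : t ≤ t') {w : List Bool}
    (hw : Certified (initSeg p t) x w) : Certified (initSeg p t') x w := by
  obtain ⟨s, hs, hmem, hstep⟩ := hw
  rw [initSeg_length] at hs
  exact ⟨s, by rw [initSeg_length]; omega, hmem,
    fun v hv => (hstep v hv).mono h (List.Subset.refl _)⟩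

theorem exists_certified {t : ℕ} {S : List (List Bool)}
    (hS : ∀ v ∈ S, CertStep (initSeg p t) x S v) {w : List Bool} (hw : w ∈ S) :
    ∃ t', Certified (initSeg p t') x w := by
  refine ⟨max t (Encodable.encode S + 1), Encodable.encode S, ?_, ?_, ?_⟩
  · rw [initSeg_length]; omega
  · rwa [certOfNat_encode]
  · rw [certOfNat_encode]
    exact fun v hv => (hS v hv).mono (le_max_left _ _) (List.Subset.refl _)

theorem exists_certified_of_covered {v : List Bool} {j k : ℕ} (hj : j ≤ v.length)
    (h : p (outcomeIdx x (k + 1)) = Encodable.encode (v.take j) + 1) :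
    ∃ t, Certified (initSeg p t) x v := by
  refine exists_certified (t := outcomeIdx x (k + 1) + k + 1) (S := [v]) (fun v' hv' => ?_)
    (List.mem_singleton_self v)
  obtain rfl := List.mem_singleton.1 hv'
  refine Or.inl ⟨j, by omega, k, by rw [initSeg_length]; omega, ?_⟩
  rw [getD_initSeg p (by omega), h]

/-- The two certificates together with `w` form a certificate; its code may be larger, hence the
later stage. -/
theorem Certified.exists_of_both {t : ℕ} {w : List Bool}
    (h : ∀ b, Certified (initSeg p t) x (w ++ [b])) : ∃ t', Certified (initSeg p t') x w := by
  obtain ⟨s, -, hm, hs⟩ := h false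
  obtain ⟨s', -, hm', hs'⟩ := h true
  refine exists_certified (t := t) (S := w :: (certOfNat s ++ certOfNat s')) (fun v hv => ?_)
    List.mem_cons_self
  rcases List.mem_cons.1 hv with rfl | hv
  · exact Or.inr (Or.inl ⟨List.mem_cons_of_mem _ (List.mem_append_left _ hm),
      List.mem_cons_of_mem _ (List.mem_append_right _ hm')⟩)
  · rcases List.mem_append.1 hv with hv | hv
    · exact (hs v hv).mono le_rfl fun a ha => List.mem_cons_of_mem _ (List.mem_append_left _ ha)
    · exact (hs' v hv).mono le_rfl fun a ha => List.mem_cons_of_mem _ (List.mem_append_right _ ha)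

theorem Certified.exists_of_openMoves {t : ℕ} {w : List Bool} {b : Bool}
    (h : Certified (initSeg p t) x (w ++ [b])) (ho : p (outcomeIdx x 0) = p (moverIdx w)) :
    ∃ t', Certified (initSeg p t') x w := by
  obtain ⟨s, -, hm, hs⟩ := h
  obtain ⟨t₀, hk⟩ := exists_known p x w
  have hk' := hk.mono (le_max_right t t₀)
  refine exists_certified (t := max t t₀) (S := w :: certOfNat s) (fun v hv => ?_)
    List.mem_cons_self
  rcases List.mem_cons.1 hv with rfl | hv
  · refine Or.inr (Or.inr ⟨?_, hk', hk'.openMoves_iff.2 ho⟩)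
    cases b
    · exact Or.inl (List.mem_cons_of_mem _ hm)
    · exact Or.inr (List.mem_cons_of_mem _ hm)
  · exact (hs v hv).mono (le_max_left _ _) fun a ha => List.mem_cons_of_mem _ ha

/-- All words in a certificate are certified by that same certificate, so descending does not raise
the stage `t`. -/
theorem Certified.cases {t : ℕ} {w : List Bool} (h : Certified (initSeg p t) x w) :
    Covered (initSeg p t) x w ∨ (∀ b, Certified (initSeg p t) x (w ++ [b])) ∨
      ((∃ b, Certified (initSeg p t) x (w ++ [b])) ∧ Known (initSeg p t) x w ∧
        p (outcomeIdx x 0) = p (moverIdx w)) := by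
  obtain ⟨s, hs, hm, hstep⟩ := h
  have mem : ∀ v ∈ certOfNat s, Certified (initSeg p t) x v := fun v hv => ⟨s, hs, hv, hstep⟩
  rcases hstep w hm with h | ⟨h, h'⟩ | ⟨h, hk, ho⟩
  · exact Or.inl h
  · refine Or.inr (Or.inl fun b => ?_)
    cases b
    · exact mem _ h
    · exact mem _ h'
  · refine Or.inr (Or.inr ⟨?_, hk, hk.openMoves_iff.1 ho⟩)
    rcases h with h | h
    · exact ⟨_, mem _ h⟩
    · exact ⟨_, mem _ h⟩

/-- A stage admits only finitely many certificates, each finite. The bound takes the place of a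
rank: no play can remain certified forever at a fixed stage. -/
theorem exists_length_bound (U : List ℕ) (x : ℕ) :
    ∃ M, ∀ w, Certified U x w → w.length ≤ M := by
  have hfin : (⋃ s ∈ {s | s < U.length}, {w | w ∈ certOfNat s}).Finite :=
    (Set.finite_lt_nat _).biUnion fun s _ => List.finite_toSet _
  obtain ⟨M, hM⟩ := (hfin.image List.length).bddAbove
  refine ⟨M, fun w ⟨s, hs, hm, _⟩ => hM ⟨w, ?_, rfl⟩⟩
  simp only [Set.mem_iUnion]
  exact ⟨s, hs, hm⟩

/-! ## Strategies that are good for both players -/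

/-- The information `U` shows that `b` is the wrong move at `w` in the game about the outcome `x`:
the open player should move to the successor that is certified first, his opponent to the
successor that is certified last. -/
def BadMove (U : List ℕ) (x : ℕ) (w : List Bool) (b : Bool) : Prop :=
  Known U x w ∧
    ((OpenMoves U x w ∧ ¬ Certified U x (w ++ [b]) ∧ Certified U x (w ++ [!b])) ∨
      (¬ OpenMoves U x w ∧ Certified U x (w ++ [b]) ∧ ¬ Certified U x (w ++ [!b])))

/-- Certification is monotone in the stage, so one successor is certified whenever the other is. The
open player may choose it, his opponent the other one. -/
theorem exists_not_badMove (p : ℕ → ℕ) (x : ℕ) (w : List Bool) :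
    ∃ b, ∀ t, ¬ BadMove (initSeg p t) x w b := by
  have first : ∃ c, ∀ t, Certified (initSeg p t) x (w ++ [!c]) →
      Certified (initSeg p t) x (w ++ [c]) := by
    by_cases h : ∀ t, Certified (initSeg p t) x (w ++ [true]) →
        Certified (initSeg p t) x (w ++ [false])
    · exact ⟨false, h⟩
    · push Not at h
      obtain ⟨t₀, h1, h2⟩ := h
      refine ⟨true, fun t ht => ?_⟩
      rcases le_total t₀ t with hle | hle
      · exact h1.mono hle
      · exact absurd (Certified.mono hle ht) h2
  obtain ⟨c, hc⟩ := first
  by_cases ho : p (outcomeIdx x 0) = p (moverIdx w)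
  · refine ⟨c, fun t ht => ?_⟩
    obtain ⟨hk, ⟨-, h1, h2⟩ | ⟨h, -⟩⟩ := ht
    · exact h1 (hc t h2)
    · exact h (hk.openMoves_iff.2 ho)
  · refine ⟨!c, fun t ht => ?_⟩
    obtain ⟨hk, ⟨h, -⟩ | ⟨-, h1, h2⟩⟩ := ht
    · exact ho (hk.openMoves_iff.1 h)
    · rw [Bool.not_not] at h2
      exact h2 (hc t h1)

variable {str : List Bool → Bool} {z : ℕ → Bool}

/-- Outside the open set the play would stay certified at the same stage `t`: if some successor is
certified by then, so is the one that is not a bad move. This contradicts the length bound. -/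
theorem mem_enumeratedOpen_of_certified
    (hstr : ∀ w t, ¬ BadMove (initSeg p t) x w (str w)) {t : ℕ}
    (ht : Certified (initSeg p t) x [])
    (hz : ∀ k, p (moverIdx (initSeg z k)) = p (outcomeIdx x 0) → z k = str (initSeg z k)) :
    z ∈ enumeratedOpen fun k => p (outcomeIdx x (k + 1)) := by
  by_contra hno
  have key : ∀ k, Certified (initSeg p t) x (initSeg z k) := by
    intro k
    induction k with
    | zero => exact ht
    | succ k ih =>
      rw [initSeg_succ]
      rcases ih.cases with ⟨j, hj, l, hl, e⟩ | h | ⟨⟨b, hb⟩, hk, ho⟩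
      · rw [initSeg_length] at hj
        rw [take_initSeg z (by omega)] at e
        have := (getD_initSeg_of_ne_zero p (by rw [e]; omega)).2
        rw [e] at this
        exact absurd ⟨l, _, this.symm, mem_cylinder_initSeg z j⟩ hno
      · exact h _
      · rw [hz k ho.symm]
        by_contra hc
        refine hstr (initSeg z k) t ⟨hk, Or.inl ⟨hk.openMoves_iff.2 ho, hc, ?_⟩⟩
        have : b = !str (initSeg z k) := by
          rcases Bool.eq_or_eq_not b (str (initSeg z k)) with h | h
          · rw [h] at hb
            exact absurd hb hc
          · exact h
        rwa [← this]
  obtain ⟨M, hM⟩ := exists_length_bound (initSeg p t) x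
  have := hM _ (key (M + 1))
  rw [initSeg_length] at this
  omega

/-- Never being certified is inherited along the play: if the opponent's chosen successor were ever
certified, the other one would be as well, and therefore the position itself. Entering an enumerated
cylinder would certify an initial segment. -/
theorem notMem_enumeratedOpen_of_not_certified
    (hstr : ∀ w t, ¬ BadMove (initSeg p t) x w (str w))
    (hroot : ∀ t, ¬ Certified (initSeg p t) x [])
    (hz : ∀ k, p (moverIdx (initSeg z k)) ≠ p (outcomeIdx x 0) → z k = str (initSeg z k)) :
    z ∉ enumeratedOpen fun k => p (outcomeIdx x (k + 1)) := by
  have key : ∀ k t, ¬ Certified (initSeg p t) x (initSeg z k) := by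
    intro k
    induction k with
    | zero => exact hroot
    | succ k ih =>
      intro t ht
      rw [initSeg_succ] at ht
      by_cases ho : p (outcomeIdx x 0) = p (moverIdx (initSeg z k))
      · obtain ⟨t', ht'⟩ := ht.exists_of_openMoves ho
        exact ih t' ht'
      · rw [hz k fun h => ho h.symm] at ht
        obtain ⟨t₀, hk⟩ := exists_known p x (initSeg z k)
        have hk' := hk.mono (le_max_right t t₀)
        have ht' := ht.mono (le_max_left t t₀)
        have hother : Certified (initSeg p (max t t₀)) x
            (initSeg z k ++ [!str (initSeg z k)]) := by
          by_contra hc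
          exact hstr _ _ ⟨hk', Or.inr ⟨fun h => ho (hk'.openMoves_iff.1 h), ht', hc⟩⟩
        obtain ⟨t', h⟩ := Certified.exists_of_both (w := initSeg z k) fun b => by
          rcases Bool.eq_or_eq_not b (str (initSeg z k)) with h | h
          · rw [h]; exact ht'
          · rw [h]; exact hother
        exact ih t' h
  rintro ⟨k, u, hk, hu⟩
  obtain ⟨t, ht⟩ := exists_certified_of_covered (p := p) (x := x) (v := u) (j := u.length)
    (k := k) le_rfl (by rw [List.take_length]; exact hk)
  refine key u.length t ?_
  rwa [cylinder_eq hu]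

end

/-! ## The instance of `C × LPO*` for a game -/

/-- The binary word with number `e`. -/
def wordOfNat (e : ℕ) : List Bool := (Encodable.decode e).getD []

theorem wordOfNat_encode (w : List Bool) : wordOfNat (Encodable.encode w) = w := by
  simp [wordOfNat]

/-- A point `z` of Cantor space stands for the family of profiles `w ↦ z ⟨x, w⟩`; the information
`U` shows that the value `b` at position `i` is a bad move. -/
def BadValue (U : List ℕ) (i : ℕ) (b : Bool) : Prop :=
  BadMove U i.unpair.1 (wordOfNat i.unpair.2) b

open Classical in
/-- The enumeration of cylinders of families that contain a bad move. -/
noncomputable def badEnum (U : List ℕ) (j : ℕ) : ℕ :=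
  (Encodable.decode (α := List Bool) j.unpair.1).elim 0 fun u =>
    if 0 < u.length ∧ BadValue (U.take j.unpair.2) (u.length - 1) (u.getD (u.length - 1) false) then
      Encodable.encode u + 1 else 0

/-- An index codes a word and a stage, and the stage never exceeds the index, so the prefix is long
enough. Testing the last letter suffices because every position of `z` ends some initial segment. -/
theorem mem_enumeratedOpen_badEnum (p : ℕ → ℕ) {N : ℕ → ℕ} (hN : ∀ j, j ≤ N j) (z : ℕ → Bool) :
    z ∈ enumeratedOpen (fun j => badEnum (initSeg p (N j)) j) ↔
      ∃ i t, BadValue (initSeg p t) i (z i) := by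
  have htake : ∀ j, (initSeg p (N j)).take j.unpair.2 = initSeg p j.unpair.2 := fun j =>
    take_initSeg p ((Nat.unpair_right_le j).trans (hN j))
  constructor
  · rintro ⟨j, w, hj, hz⟩
    unfold badEnum at hj
    cases hd : Encodable.decode (α := List Bool) j.unpair.1 with
    | none => simp [hd] at hj
    | some w' =>
      simp only [hd, Option.elim_some] at hj
      split_ifs at hj with hb
      obtain rfl : w' = w := Encodable.encode_injective (by omega)
      rw [htake] at hb
      refine ⟨w'.length - 1, j.unpair.2, ?_⟩
      have h := hb.2
      rwa [← cylinder_eq hz, getD_initSeg_bool z (by rw [initSeg_length]; omega),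
        initSeg_length] at h
  · rintro ⟨i, t, h⟩
    refine ⟨Nat.pair (Encodable.encode (initSeg z (i + 1))) t, initSeg z (i + 1), ?_,
      mem_cylinder_initSeg _ _⟩
    simp only [badEnum, Nat.unpair_pair, Encodable.encodek, Option.elim_some]
    refine if_pos ⟨by rw [initSeg_length]; omega, ?_⟩
    rwa [htake, Nat.unpair_pair, initSeg_length, Nat.add_sub_cancel,
      getD_initSeg_bool z (Nat.lt_succ_self i)]

/-- Badness concerns one position at a time, so the values can be chosen independently. This puts
the instance in the domain of closed choice. -/
theorem exists_forall_not_badValue (p : ℕ → ℕ) :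
    ∃ z : ℕ → Bool, ∀ i t, ¬ BadValue (initSeg p t) i (z i) := by
  choose z hz using fun i : ℕ => exists_not_badMove p i.unpair.1 (wordOfNat i.unpair.2)
  exact ⟨z, hz⟩

theorem not_badMove_of_not_badValue {p : ℕ → ℕ} {z : ℕ → Bool}
    (hz : ∀ i t, ¬ BadValue (initSeg p t) i (z i)) (x : ℕ) (w : List Bool) (t : ℕ) :
    ¬ BadMove (initSeg p t) x w (z (Nat.pair x (Encodable.encode w))) := by
  have := hz (Nat.pair x (Encodable.encode w)) t
  rwa [BadValue, Nat.unpair_pair, wordOfNat_encode] at this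

/-- The closed set of all families of profiles without bad moves. -/
noncomputable def goodFamilies (p : ℕ → ℕ) : TopologicalSpace.Closeds (ℕ → Bool) :=
  ⟨(enumeratedOpen fun j => badEnum (initSeg p (2 * j + 2)) j)ᶜ,
    (isOpen_enumeratedOpen _).isClosed_compl⟩

theorem mem_goodFamilies {p : ℕ → ℕ} {z : ℕ → Bool} :
    z ∈ goodFamilies p ↔ ∀ i t, ¬ BadValue (initSeg p t) i (z i) := by
  change ¬ z ∈ enumeratedOpen (fun j => badEnum (initSeg p (2 * j + 2)) j) ↔ _
  rw [mem_enumeratedOpen_badEnum p (fun j => by omega)]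
  push Not
  rfl

open Classical in
/-- The sequence that is zero if and only if the open player does not win the game about `x`. -/
noncomputable def rootSeq (p : ℕ → ℕ) (x t : ℕ) : ℕ :=
  if Certified (initSeg p t) x [] then 1 else 0

open Classical in
/-- The entry at position `m` of the name of the instance of `C × LPO*`. -/
noncomputable def nashInstanceEntry (u : List ℕ) (m : ℕ) : ℕ :=
  if m % 2 = 0 then badEnum u (m / 2) else
  if m = 1 then u.getD 0 0 else
    if Certified (u.take ((m - 3) / 2).unpair.2) ((m - 3) / 2).unpair.1 [] then 1 else 0

/-- The entry of the name of the instance of `C × LPO*` computed from a prefix of the name of a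
game. -/
noncomputable def nashInstanceOfPrefix (u : List ℕ) : ℕ :=
  nashInstanceEntry u (u.length - 2)

theorem prefixFun_nashInstanceOfPrefix (p : ℕ → ℕ) (m : ℕ) :
    prefixFun nashInstanceOfPrefix p m = nashInstanceEntry (initSeg p (m + 2)) m := by
  simp [prefixFun, nashInstanceOfPrefix, initSeg_length]

theorem names_nashInstance (p : ℕ → ℕ) :
    Names (prefixFun nashInstanceOfPrefix p)
      ((goodFamilies p, ⟨p 0, fun i => rootSeq p i⟩) :
        TopologicalSpace.Closeds (ℕ → Bool) × Σ n : ℕ, Fin n → ℕ → ℕ) := by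
  refine ⟨?_, ?_, fun i => ?_⟩
  · have : (fun n => prefixFun nashInstanceOfPrefix p (2 * n)) =
        fun j => badEnum (initSeg p (2 * j + 2)) j := by
      funext j
      rw [prefixFun_nashInstanceOfPrefix, nashInstanceEntry, if_pos (by omega)]
      congr 1
      omega
    rw [this]
    rfl
  · change prefixFun nashInstanceOfPrefix p 1 = p 0
    rw [prefixFun_nashInstanceOfPrefix, nashInstanceEntry, if_neg (by omega), if_pos rfl,
      getD_initSeg p (by omega)]
  · funext t
    change prefixFun nashInstanceOfPrefix p (2 * (Nat.pair i t + 1) + 1) = rootSeq p i t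
    have h : (2 * (Nat.pair i t + 1) + 1 - 3) / 2 = Nat.pair i t := by omega
    have := Nat.right_le_pair i t
    rw [prefixFun_nashInstanceOfPrefix, nashInstanceEntry, if_neg (by omega), if_neg (by omega), h,
      Nat.unpair_pair, take_initSeg p (by omega)]
    rfl

/-! ### Primitive recursiveness of the instance. -/

section

variable {α : Type*} [Primcodable α] {U : α → List ℕ} {x i : α → ℕ} {v : α → List Bool}
  {b : α → Bool} {S : α → List (List Bool)}

theorem primrec_outcomeIdx {k : α → ℕ} (hx : Primrec x) (hk : Primrec k) :
    Primrec fun a => outcomeIdx (x a) (k a) :=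
  primrec_nat_pair (primrec_succ (primrec_succ (primrec_succ
    (primrec_nat_pair (Primrec.const 0) hx)))) hk

theorem primrec_moverIdx (hv : Primrec v) : Primrec fun a => moverIdx (v a) :=
  primrec_nat_pair (Primrec.const 1) (primrec_encode_word.comp hv)

theorem primrecPred_covered (hU : Primrec U) (hx : Primrec x) (hv : Primrec v) :
    PrimrecPred fun a => Covered (U a) (x a) (v a) := by
  refine primrecPred_exists_lt (primrec_succ (Primrec.list_length.comp hv))
    (primrecPred_exists_lt (Primrec.list_length.comp (hU.comp Primrec.fst)) ?_)
  have h1 : Primrec fun c : (α × ℕ) × ℕ => c.1.1 := Primrec.fst.comp Primrec.fst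
  exact Primrec.eq.comp
    (primrec_getD (hU.comp h1) (primrec_outcomeIdx (hx.comp h1) (primrec_succ Primrec.snd)))
    (primrec_succ (primrec_encode_word.comp
      (Primrec.list_take.comp (Primrec.snd.comp Primrec.fst) (hv.comp h1))))

theorem primrecPred_known (hU : Primrec U) (hx : Primrec x) (hv : Primrec v) :
    PrimrecPred fun a => Known (U a) (x a) (v a) :=
  (Primrec.nat_lt.comp (primrec_outcomeIdx hx (Primrec.const 0)) (Primrec.list_length.comp hU)).and
    (Primrec.nat_lt.comp (primrec_moverIdx hv) (Primrec.list_length.comp hU))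

theorem primrecPred_openMoves (hU : Primrec U) (hx : Primrec x) (hv : Primrec v) :
    PrimrecPred fun a => OpenMoves (U a) (x a) (v a) :=
  Primrec.eq.comp (primrec_getD hU (primrec_outcomeIdx hx (Primrec.const 0)))
    (primrec_getD hU (primrec_moverIdx hv))

theorem primrecPred_certStep (hU : Primrec U) (hx : Primrec x) (hS : Primrec S)
    (hv : Primrec v) : PrimrecPred fun a => CertStep (U a) (x a) (S a) (v a) := by
  have hb : ∀ b : Bool, PrimrecPred fun a => v a ++ [b] ∈ S a := fun b =>
    primrecPred_mem hS (Primrec.list_concat.comp hv (Primrec.const b))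
  exact (primrecPred_covered hU hx hv).or (((hb false).and (hb true)).or
    (((hb false).or (hb true)).and
      ((primrecPred_known hU hx hv).and (primrecPred_openMoves hU hx hv))))

theorem primrec_certOfNat : Primrec certOfNat :=
  Primrec.option_getD.comp Primrec.decode (Primrec.const [])

theorem primrecPred_certified (hU : Primrec U) (hx : Primrec x) (hv : Primrec v) :
    PrimrecPred fun a => Certified (U a) (x a) (v a) := by
  refine primrecPred_exists_lt (Primrec.list_length.comp hU) (PrimrecPred.and
    (primrecPred_mem (primrec_certOfNat.comp Primrec.snd) (hv.comp Primrec.fst))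
    (primrecPred_forall_mem (primrec_certOfNat.comp Primrec.snd) ?_))
  have h1 : Primrec fun c : (α × ℕ) × List Bool => c.1.1 := Primrec.fst.comp Primrec.fst
  exact primrecPred_certStep (hU.comp h1) (hx.comp h1)
    (primrec_certOfNat.comp (Primrec.snd.comp Primrec.fst)) Primrec.snd

theorem primrecPred_badValue (hU : Primrec U) (hi : Primrec i) (hb : Primrec b) :
    PrimrecPred fun a => BadValue (U a) (i a) (b a) := by
  have hx := primrec_unpair_fst hi
  have hw : Primrec fun a => wordOfNat (i a).unpair.2 :=
    Primrec.option_getD.comp (primrec_decode_word.comp (primrec_unpair_snd hi)) (Primrec.const [])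
  have ho := primrecPred_openMoves hU hx hw
  have hc := primrecPred_certified hU hx (Primrec.list_concat.comp hw hb)
  have hc' := primrecPred_certified hU hx (Primrec.list_concat.comp hw (Primrec.not.comp hb))
  exact (primrecPred_known hU hx hw).and
    ((ho.and (hc.not.and hc')).or (ho.not.and (hc.and hc'.not)))

end

open Classical in
theorem primrec_badEnum : Primrec₂ badEnum := by
  refine primrec_elim_zero (primrec_decode_word.comp (primrec_unpair_fst Primrec.snd)) ?_
  have hl : Primrec fun a : (List ℕ × ℕ) × List Bool => a.2.length :=
    Primrec.list_length.comp Primrec.snd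
  have hl' := Primrec.nat_sub.comp hl (Primrec.const 1)
  refine Primrec.ite ((Primrec.nat_lt.comp (Primrec.const 0) hl).and
      (primrecPred_badValue ?_ hl' ((Primrec.list_getD false).comp Primrec.snd hl')))
    (primrec_succ (primrec_encode_word.comp Primrec.snd)) (Primrec.const 0)
  exact Primrec.list_take.comp (primrec_unpair_snd (Primrec.snd.comp Primrec.fst))
    (Primrec.fst.comp Primrec.fst)

open Classical in
theorem primrec_nashInstanceOfPrefix : Primrec nashInstanceOfPrefix := by
  have hm : Primrec fun u : List ℕ => u.length - 2 :=
    Primrec.nat_sub.comp Primrec.list_length (Primrec.const 2)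
  have hj : Primrec fun u : List ℕ => (u.length - 2 - 3) / 2 :=
    Primrec.nat_div.comp (Primrec.nat_sub.comp hm (Primrec.const 3)) (Primrec.const 2)
  refine Primrec.ite
    (Primrec.eq.comp (Primrec.nat_mod.comp hm (Primrec.const 2)) (Primrec.const 0))
    (primrec_badEnum.comp Primrec.id (Primrec.nat_div.comp hm (Primrec.const 2))) ?_
  refine Primrec.ite (Primrec.eq.comp hm (Primrec.const 1))
    (primrec_getD Primrec.id (Primrec.const 0)) ?_
  exact Primrec.ite (primrecPred_certified
      (Primrec.list_take.comp (primrec_unpair_snd hj) Primrec.id) (primrec_unpair_fst hj)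
      (Primrec.const [])) (Primrec.const 1) (Primrec.const 0)

/-! ## Reading off an equilibrium -/

/-- The position, in the pair of a name of a game and a solution of its instance of `C × LPO*`,
of the answer about the outcome `x`. -/
def answerIdx (x : ℕ) : ℕ := 2 * (2 * (Nat.pair x 0 + 1) + 1) + 1

/-- The position, in the pair, of the move at the word with number `m` in the game about `x`. -/
def familyIdx (x m : ℕ) : ℕ := 2 * (2 * Nat.pair x m) + 1

/-- The position, in the pair, of the comparison of `y` and `x` by player `d`. -/
def prefIdx (d y x : ℕ) : ℕ := 2 * Nat.pair 2 (Nat.pair d (Nat.pair y x))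

/-- Player `0` wins the game about `x` and `d = 0`, or he does not and `d = 1`. -/
def Good (U : List ℕ) (d x : ℕ) : Prop :=
  ¬ (U.getD (2 * outcomeIdx x 0) 0 = U.getD (answerIdx x) 0 ↔ d = 1)

/-- The outcome `x` is the best good one for player `d`. -/
def Best (U : List ℕ) (d x : ℕ) : Prop :=
  Good U d x ∧ ∀ y < U.getD 0 0, Good U d y → y = x ∨ U.getD (prefIdx d y x) 0 = 1

open Classical in
/-- A best good outcome for player `d`, or `0` if there is none. -/
noncomputable def bestOutcome (U : List ℕ) (d : ℕ) : ℕ :=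
  ((List.range (U.getD 0 0)).filter fun x => Best U d x).headI

/-- The number of the player who moves at the word with number `m`. -/
def moverOf (U : List ℕ) (m : ℕ) : ℕ := U.getD (2 * Nat.pair 1 m) 0

/-- The information `U` suffices to find the move at the word with number `m`. -/
def Ready (U : List ℕ) (m : ℕ) : Prop :=
  0 < U.length ∧ 2 * Nat.pair 1 m < U.length ∧ ∀ x < U.getD 0 0 + 1,
    2 * outcomeIdx x 0 < U.length ∧ answerIdx x < U.length ∧ familyIdx x m < U.length ∧
      ∀ y < U.getD 0 0 + 1, prefIdx (moverOf U m) y x < U.length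

open Classical in
/-- The equilibrium computed from a word of the pair of a name of the game and a solution of its
instance of `C × LPO*`. -/
noncomputable def nashSolution (U : List ℕ) (m : ℕ) : Option ℕ :=
  if Ready U m then some (U.getD (familyIdx (bestOutcome U (moverOf U m)) m) 0) else none

/-! ### Primitive recursiveness of the solution. -/

section

variable {α : Type*} [Primcodable α] {U : α → List ℕ} {d x m : α → ℕ}

theorem primrec_answerIdx (hx : Primrec x) : Primrec fun a => answerIdx (x a) :=
  primrec_succ (primrec_double (primrec_succ (primrec_double
    (primrec_succ (primrec_nat_pair hx (Primrec.const 0))))))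

theorem primrec_familyIdx (hx : Primrec x) (hm : Primrec m) :
    Primrec fun a => familyIdx (x a) (m a) :=
  primrec_succ (primrec_double (primrec_double (primrec_nat_pair hx hm)))

theorem primrec_prefIdx {y : α → ℕ} (hd : Primrec d) (hy : Primrec y) (hx : Primrec x) :
    Primrec fun a => prefIdx (d a) (y a) (x a) :=
  primrec_double (primrec_nat_pair (Primrec.const 2) (primrec_nat_pair hd (primrec_nat_pair hy hx)))

theorem primrecPred_good (hU : Primrec U) (hd : Primrec d) (hx : Primrec x) :
    PrimrecPred fun a => Good (U a) (d a) (x a) := by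
  have h1 : PrimrecPred fun a => (U a).getD (2 * outcomeIdx (x a) 0) 0 =
      (U a).getD (answerIdx (x a)) 0 :=
    Primrec.eq.comp (primrec_getD hU (primrec_double (primrec_outcomeIdx hx (Primrec.const 0))))
      (primrec_getD hU (primrec_answerIdx hx))
  have h2 : PrimrecPred fun a => d a = 1 := Primrec.eq.comp hd (Primrec.const 1)
  exact ((h1.and h2.not).or (h2.and h1.not)).of_eq fun a => by unfold Good; tauto

theorem primrecPred_best (hU : Primrec U) (hd : Primrec d) (hx : Primrec x) :
    PrimrecPred fun a => Best (U a) (d a) (x a) := by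
  refine (primrecPred_good hU hd hx).and
    (primrecPred_forall_lt (primrec_getD hU (Primrec.const 0)) ?_)
  have hg : PrimrecPred fun c : α × ℕ => Good (U c.1) (d c.1) c.2 :=
    primrecPred_good (hU.comp Primrec.fst) (hd.comp Primrec.fst) Primrec.snd
  have he : PrimrecPred fun c : α × ℕ => c.2 = x c.1 ∨
      (U c.1).getD (prefIdx (d c.1) c.2 (x c.1)) 0 = 1 :=
    (Primrec.eq.comp Primrec.snd (hx.comp Primrec.fst)).or
      (Primrec.eq.comp (primrec_getD (hU.comp Primrec.fst)
        (primrec_prefIdx (hd.comp Primrec.fst) Primrec.snd (hx.comp Primrec.fst)))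
        (Primrec.const 1))
  exact (hg.not.or he).of_eq fun c => imp_iff_not_or.symm

theorem primrec_bestOutcome (hU : Primrec U) (hd : Primrec d) :
    Primrec fun a => bestOutcome (U a) (d a) := by
  classical
  have hR : PrimrecRel fun (x : ℕ) (a : α) => Best (U a) (d a) x :=
    primrecPred_best (hU.comp Primrec.snd) (hd.comp Primrec.snd) Primrec.fst
  refine (Primrec.list_headI.comp ((PrimrecRel.listFilter hR).comp
    (Primrec.list_range.comp (primrec_getD hU (Primrec.const 0))) Primrec.id)).of_eq fun a => ?_
  unfold bestOutcome
  congr!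

theorem primrec_moverOf (hU : Primrec U) (hm : Primrec m) :
    Primrec fun a => moverOf (U a) (m a) :=
  primrec_getD hU (primrec_double (primrec_nat_pair (Primrec.const 1) hm))

theorem primrecPred_ready (hU : Primrec U) (hm : Primrec m) :
    PrimrecPred fun a => Ready (U a) (m a) := by
  have hl := Primrec.list_length.comp hU
  have hn := primrec_succ (primrec_getD hU (Primrec.const 0))
  have h1 : Primrec fun c : α × ℕ => (U c.1).length := hl.comp Primrec.fst
  have h2 : Primrec fun c : (α × ℕ) × ℕ => c.1.1 := Primrec.fst.comp Primrec.fst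
  refine (Primrec.nat_lt.comp (Primrec.const 0) hl).and ((Primrec.nat_lt.comp
    (primrec_double (primrec_nat_pair (Primrec.const 1) hm)) hl).and
    (primrecPred_forall_lt hn ?_))
  refine (Primrec.nat_lt.comp (primrec_double (primrec_outcomeIdx Primrec.snd (Primrec.const 0)))
    h1).and ((Primrec.nat_lt.comp (primrec_answerIdx Primrec.snd) h1).and
    ((Primrec.nat_lt.comp (primrec_familyIdx Primrec.snd (hm.comp Primrec.fst)) h1).and
    (primrecPred_forall_lt (hn.comp Primrec.fst) ?_)))
  exact Primrec.nat_lt.comp (primrec_prefIdx (primrec_moverOf (hU.comp h2) (hm.comp h2))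
    Primrec.snd (Primrec.snd.comp Primrec.fst)) (hl.comp h2)

end

open Classical in
theorem primrec_nashSolution : Primrec₂ nashSolution :=
  Primrec.ite (primrecPred_ready Primrec.fst Primrec.snd)
    (Primrec.option_some.comp (primrec_getD Primrec.fst (primrec_familyIdx
      (primrec_bestOutcome Primrec.fst (primrec_moverOf Primrec.fst Primrec.snd)) Primrec.snd)))
    (Primrec.const none)

/-! ### Passage from prefixes to complete information. -/

/-- `Good` on complete information. -/
def GoodOutcome (g : ℕ → ℕ) (d x : ℕ) : Prop :=
  ¬ (g (2 * outcomeIdx x 0) = g (answerIdx x) ↔ d = 1)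

/-- `Best` on complete information. -/
def BestOutcome (g : ℕ → ℕ) (d x : ℕ) : Prop :=
  GoodOutcome g d x ∧ ∀ y < g 0, GoodOutcome g d y → y = x ∨ g (prefIdx d y x) = 1

open Classical in
/-- `bestOutcome` on complete information. -/
noncomputable def bestOutcomeOf (g : ℕ → ℕ) (d : ℕ) : ℕ :=
  ((List.range (g 0)).filter fun x => BestOutcome g d x).headI

theorem headI_filter_spec {P : ℕ → Prop} [DecidablePred P] {n : ℕ} (h : ∃ x < n, P x) :
    ((List.range n).filter fun x => P x).headI < n ∧
      P ((List.range n).filter fun x => P x).headI := by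
  obtain ⟨x, hx, hP⟩ := h
  have hmem : x ∈ (List.range n).filter fun x => P x := by simp [hx, hP]
  obtain ⟨y, l, hl⟩ := List.exists_cons_of_ne_nil (List.ne_nil_of_mem hmem)
  have : y ∈ (List.range n).filter fun x => P x := by rw [hl]; exact List.mem_cons_self
  rw [hl]
  simpa using this

/-- The default `0` of an empty list is below `n + 1` even for `n = 0`; this is why `Ready` ranges
up to and including the number of outcomes. -/
theorem headI_filter_lt_succ (P : ℕ → Prop) [DecidablePred P] (n : ℕ) :
    ((List.range n).filter fun x => P x).headI < n + 1 := by
  cases hl : (List.range n).filter fun x => P x with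
  | nil => exact Nat.succ_pos n
  | cons y l =>
    have : y ∈ (List.range n).filter fun x => P x := by rw [hl]; exact List.mem_cons_self
    have : y < n := by simpa using (List.mem_filter.1 this).1
    exact this.trans (Nat.lt_succ_self n)

theorem bestOutcomeOf_spec {g : ℕ → ℕ} {d : ℕ} (h : ∃ x < g 0, BestOutcome g d x) :
    bestOutcomeOf g d < g 0 ∧ BestOutcome g d (bestOutcomeOf g d) := by
  classical
  exact headI_filter_spec h

/-- Every lookup that can influence the result lies inside the prefix, so no default value is taken
for a real entry. -/
theorem Ready.value_eq {g : ℕ → ℕ} {k m : ℕ} (h : Ready (initSeg g k) m) :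
    (initSeg g k).getD (familyIdx (bestOutcome (initSeg g k) (moverOf (initSeg g k) m)) m) 0 =
      g (familyIdx (bestOutcomeOf g (g (2 * Nat.pair 1 m))) m) := by
  classical
  obtain ⟨h0, h1, h2⟩ := h
  rw [initSeg_length] at h0 h1 h2
  have hd : moverOf (initSeg g k) m = g (2 * Nat.pair 1 m) := getD_initSeg g h1
  rw [hd, getD_initSeg g h0] at h2
  rw [hd]
  generalize g (2 * Nat.pair 1 m) = d at h2 ⊢
  have good : ∀ x < g 0, (Good (initSeg g k) d x ↔ GoodOutcome g d x) := by
    intro x hx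
    obtain ⟨h3, h4, -⟩ := h2 x (by omega)
    rw [Good, GoodOutcome, getD_initSeg g h3, getD_initSeg g h4]
  have best : ∀ x < g 0, (Best (initSeg g k) d x ↔ BestOutcome g d x) := by
    intro x hx
    obtain ⟨-, -, -, h5⟩ := h2 x (by omega)
    rw [Best, BestOutcome, good x hx, getD_initSeg g h0]
    refine and_congr_right fun _ => forall_congr' fun y => forall_congr' fun hy => ?_
    rw [good y hy, getD_initSeg g (h5 y (by omega))]
  have hbest : bestOutcome (initSeg g k) d = bestOutcomeOf g d := by
    unfold bestOutcome bestOutcomeOf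
    rw [getD_initSeg g h0]
    congr 1
    refine List.filter_congr fun x hx => ?_
    rw [decide_eq_decide]
    exact best x (List.mem_range.1 hx)
  rw [hbest]
  exact getD_initSeg g (h2 _ (headI_filter_lt_succ _ _)).2.2.1

theorem exists_ready (g : ℕ → ℕ) (m : ℕ) : ∃ N, ∀ k ≥ N, Ready (initSeg g k) m := by
  have hfin : ∀ n : ℕ, {x | x < n}.Finite := Set.finite_lt_nat
  have h1 : ∀ᶠ k in Filter.atTop, ∀ x ∈ {x | x < g 0 + 1},
      (2 * outcomeIdx x 0 < k ∧ answerIdx x < k ∧ familyIdx x m < k ∧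
        ∀ y ∈ {y | y < g 0 + 1}, prefIdx (g (2 * Nat.pair 1 m)) y x < k) := by
    rw [Filter.eventually_all_finite (hfin _)]
    intro x _
    refine (Filter.eventually_gt_atTop _).and ((Filter.eventually_gt_atTop _).and
      ((Filter.eventually_gt_atTop _).and ?_))
    rw [Filter.eventually_all_finite (hfin _)]
    exact fun y _ => Filter.eventually_gt_atTop _
  obtain ⟨N, hN⟩ := Filter.eventually_atTop.1 (((Filter.eventually_gt_atTop 0).and
    (Filter.eventually_gt_atTop (2 * Nat.pair 1 m))).and h1)
  refine ⟨N, fun k hk => ?_⟩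
  obtain ⟨⟨h0, hm⟩, h⟩ := hN k hk
  rw [Ready, moverOf, initSeg_length, getD_initSeg g h0, getD_initSeg g hm]
  exact ⟨h0, hm, h⟩

theorem approximates_nashSolution (g : ℕ → ℕ) :
    Approximates nashSolution g fun m =>
      g (familyIdx (bestOutcomeOf g (g (2 * Nat.pair 1 m))) m) := by
  refine ⟨fun k m v h => ?_, fun m => ?_⟩
  · unfold nashSolution at h
    split_ifs at h with hr
    rw [← Option.some.inj h]
    exact hr.value_eq
  · obtain ⟨N, hN⟩ := exists_ready g m
    refine ⟨N, fun k hk => ?_⟩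
    rw [nashSolution, if_pos (hN k hk)]
    rfl

/-! ### Assembling the equilibrium. -/

theorem findNash_reducible_prod_star :
    Reducible findNash (prod closedChoiceCantor (star LPO)) := by
  classical
  refine ⟨approxFun nashSolution, fun p => Part.some (prefixFun nashInstanceOfPrefix p),
    computableOnBaire_approxFun primrec_nashSolution,
    computableOnBaire_prefixFun primrec_nashInstanceOfPrefix, fun F hF => ?_⟩
  intro p G hG _
  obtain ⟨hn, hmover, hpref, hsets⟩ := hG
  have hn : p 0 = G.numOutcomes := hn
  have hmover : ∀ w : List Bool, p (moverIdx w) = G.game.mover w := hmover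
  obtain ⟨r, hr, ⟨z, ⟨n, ans⟩⟩, ⟨hz, y, hy, hyeq⟩, hrz, hrn, hrans⟩ :=
    hF _ _ (names_nashInstance p) (by
      obtain ⟨z, hz⟩ := exists_forall_not_badValue p
      exact ⟨(z, ⟨p 0, fun i => decide (∀ t, rootSeq p i t = 0)⟩), mem_goodFamilies.2 hz,
        _, fun i => decide_eq_true_iff, rfl⟩)
  cases hyeq
  have hz : ∀ i t, ¬ BadValue (initSeg p t) i (z i) := mem_goodFamilies.1 hz
  have hrz : ∀ i, r (2 * i) = (z i).toNat := hrz
  have hans : ∀ i : Fin (p 0), r (2 * (Nat.pair i 0 + 1) + 1) = (y i).toNat := hrans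
  have hy : ∀ i : Fin (p 0), y i = true ↔ ∀ t, ¬ Certified (initSeg p t) i [] := by
    intro i
    refine (hy i).trans (forall_congr' fun t => ?_)
    change (if Certified (initSeg p t) i [] then 1 else 0) = 0 ↔ _
    split_ifs with h <;> simp [h]
  set g := pairSeq p r with hg
  have g0 : g 0 = G.numOutcomes := (pairSeq_even p r 0).trans hn
  have gmover : ∀ w : List Bool, g (2 * Nat.pair 1 (Encodable.encode w)) = G.game.mover w :=
    fun w => (pairSeq_even p r _).trans (hmover w)
  have gfam : ∀ (x : ℕ) (w : List Bool), g (familyIdx x (Encodable.encode w)) =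
      (z (Nat.pair x (Encodable.encode w))).toNat := fun x w =>
    (pairSeq_odd p r _).trans (hrz _)
  have gpref : ∀ (i : Fin 2) (y x : Fin G.numOutcomes), g (prefIdx i y x) = 1 ↔
      G.game.pref i y x := by
    intro i y x
    rw [prefIdx, hg, pairSeq_even]
    rcases hpref i y x with ⟨h, e⟩ | ⟨h, e⟩
    · simp only [h, iff_true]; exact e
    · have e : p (Nat.pair 2 (Nat.pair i (Nat.pair y x))) = 0 := e
      rw [e]
      simp [h]
  -- Answer `1` means that the open player does not win. Player `0` wins with tag `0` and answer
  -- `0`, or with tag `1` and answer `1`, so the test is equality.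
  let win : Fin G.numOutcomes → Prop := fun x => g (2 * outcomeIdx x 0) = g (answerIdx x)
  have gwin : ∀ x : Fin G.numOutcomes, win x ↔
      p (outcomeIdx x 0) = if ∃ t, Certified (initSeg p t) x [] then 0 else 1 := by
    intro x
    have hx : (x : ℕ) < p 0 := x.2.trans_eq hn.symm
    have : g (answerIdx x) = (y ⟨x, hx⟩).toNat := (pairSeq_odd p r _).trans (hans ⟨x, hx⟩)
    change g _ = g _ ↔ _
    rw [this, hg, pairSeq_even]
    split_ifs with h
    · have : y ⟨x, hx⟩ = false := by
        rw [Bool.eq_false_iff, Ne, hy]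
        push Not
        exact h
      rw [this]; rfl
    · have : y ⟨x, hx⟩ = true := by
        rw [hy]
        exact fun t ht => h ⟨t, ht⟩
      rw [this]; rfl
  let str : Fin G.numOutcomes → List Bool → Bool := fun x w =>
    z (Nat.pair x (Encodable.encode w))
  have hstr : ∀ (x : Fin G.numOutcomes) (w : List Bool) (t : ℕ),
      ¬ BadMove (initSeg p t) x w (str x w) := fun x => not_badMove_of_not_badValue hz x
  have hopen : ∀ (x : Fin G.numOutcomes) (d : Fin 2), p (outcomeIdx x 0) = d →
      (∃ t, Certified (initSeg p t) x []) → ∀ u, Follows G.game d (str x) u →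
        u ∈ enumeratedOpen fun k => p (outcomeIdx x (k + 1)) := by
    rintro x d hd ⟨t, ht⟩ u hu
    refine mem_enumeratedOpen_of_certified (hstr x) ht fun k hk => hu k ?_
    rw [hmover, hd] at hk
    exact Fin.ext hk
  -- The tag `1 - d` makes the opponent of `d` the open player.
  have hclosed : ∀ (x : Fin G.numOutcomes) (d : Fin 2), p (outcomeIdx x 0) = 1 - (d : ℕ) →
      (¬ ∃ t, Certified (initSeg p t) x []) → ∀ u, Follows G.game d (str x) u →
        u ∉ enumeratedOpen fun k => p (outcomeIdx x (k + 1)) := by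
    rintro x d hd ht u hu
    refine notMem_enumeratedOpen_of_not_certified (hstr x) (not_exists.1 ht) fun k hk => hu k ?_
    rw [hmover, hd] at hk
    omega
  have hU : ∀ x : Fin G.numOutcomes,
      (p (outcomeIdx x 0) = 0 ∧ (G.upperPlays 0 x).1 =
        enumeratedOpen fun k => p (outcomeIdx x (k + 1))) ∨
      (p (outcomeIdx x 0) = 1 ∧ (G.upperPlays 0 x).1 =
        (enumeratedOpen fun k => p (outcomeIdx x (k + 1)))ᶜ) := fun x => hsets 0 x
  -- At each history the mover follows the profile for his own best target.
  refine ⟨_, Part.mem_bind (Part.mem_some _) (Part.mem_bind hr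
    (mem_approxFun.2 (approximates_nashSolution g))),
    fun w => z (Nat.pair (bestOutcomeOf g (G.game.mover w)) (Encodable.encode w)), ?_, fun w => ?_⟩
  swap
  · dsimp only
    rw [gmover, gfam]
  -- This serves both players, with `P` being `win` or its negation. If no outcome satisfies `P`,
  -- the premise fails and the default target plays no role.
  have best : ∀ (d : Fin 2) (P : Fin G.numOutcomes → Prop),
      (∀ x : Fin G.numOutcomes, GoodOutcome g d x ↔ P x) →
      (∃ x, P x ∧ ∀ y, P y → y = x ∨ G.game.pref d y x) →
      ∃ x, (P x ∧ ∀ y, P y → y = x ∨ G.game.pref d y x) ∧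
        ∀ w, G.game.mover w = d →
          z (Nat.pair (bestOutcomeOf g (G.game.mover w)) (Encodable.encode w)) = str x w := by
    intro d P hP hex
    have hiff : ∀ x : Fin G.numOutcomes,
        BestOutcome g d x ↔ P x ∧ ∀ y, P y → y = x ∨ G.game.pref d y x := by
      intro x
      rw [BestOutcome, hP, g0]
      refine and_congr_right fun _ => ⟨fun h y hy => ?_, fun h y hy hgy => ?_⟩
      · rw [Fin.ext_iff, ← gpref]
        exact h y y.2 ((hP y).2 hy)
      · have := h ⟨y, hy⟩ ((hP ⟨y, hy⟩).1 hgy)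
        rwa [Fin.ext_iff, ← gpref] at this
    obtain ⟨x, hx⟩ := hex
    obtain ⟨hlt, hb⟩ := bestOutcomeOf_spec (g := g) (d := d)
      ⟨x, by rw [g0]; exact x.2, (hiff x).2 hx⟩
    rw [g0] at hlt
    refine ⟨⟨_, hlt⟩, (hiff ⟨_, hlt⟩).1 hb, fun w hw => ?_⟩
    rw [hw]
  refine G.isNash_of_win (win := win) (str := str) (fun x hx u hu => ?_) (fun x hx u hu => ?_)
    (best 0 win fun x => ?_) (best 1 (fun x => ¬ win x) fun x => ?_)
  · rw [gwin] at hx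
    rcases hU x with ⟨h, e⟩ | ⟨h, e⟩
    · rw [e]
      split_ifs at hx with hc
      · exact hopen x 0 h hc u hu
      · omega
    · rw [e]
      split_ifs at hx with hc
      · omega
      · exact hclosed x 0 h hc u hu
  · rw [gwin] at hx
    rcases hU x with ⟨h, e⟩ | ⟨h, e⟩
    · rw [e]
      split_ifs at hx with hc
      · omega
      · exact hclosed x 1 h hc u hu
    · rw [e, Set.notMem_compl_iff]
      split_ifs at hx with hc
      · exact hopen x 1 h hc u hu
      · omega
  · simp [GoodOutcome, win]
  · simp [GoodOutcome, win]

end Weihrauch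

theorem theorem29 :
    Weihrauch.Equivalent Weihrauch.findNash
      (Weihrauch.prod Weihrauch.closedChoiceCantor (Weihrauch.star Weihrauch.LPO)) := by
  exact ⟨Weihrauch.findNash_reducible_prod_star, Weihrauch.prod_star_reducible_findNash⟩
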